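/- **Definitions.** Let $C(0)$ be the set of functions $\gamma:\mathbb C\to\mathbb C$ with $\lim_{t\to0}\gamma(t)=\gamma(0)=0$ and $|\gamma(t)|\ge|t|$ whenever $|t|\le1$. For a complex topological vector space $X$ let $\mathcal N(X)$ be the set of neighbourhoods of $0$. For $\gamma\in C(0)$ and $U\in\mathcal N(X)$ let $X^{(\gamma,U)}$ be the set of continuous functions $f:X\to\mathbb C$ with $f(0)=0$ such that for all $x\in X$, $u\in U$ and $|t|\le1$ there are $r,s\in\mathbb C$ with $|r-1|\le|\gamma(t)|$, $|s|\le|\gamma(t)|$ and $f(x+tu)=rf(x)+sf(u)$. Let $[X^{(\gamma,U)}]$ be its linear span in $\mathbb C^X$; the $w*$ topology on it is the topology of pointwise convergence on $X$. On $\mathbb R^n$, let $\mathscr D_a$ ($a>0$) be the Fréchet space of smooth complex functions vanishing for $|x|>a$ (Euclidean norm), $\mathscr D$ the space of smooth compactly supported functions with its usual (LF) topology, and $\mathscr S$ the Schwartz space. For $z=x+iy\in\mathbb C^n$ put $|y|_1=\sum_j|y_j|$. Let $Z(a)$ be the space of entire functions $\zeta$ on $\mathbb C^n$ for which every norm $\|\zeta\|_p=\sup_{z=x+iy\in\mathbb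 C^n,\,|\alpha|\le p}|z^\alpha\zeta(z)|e^{-a|y|_1}$ ($p=0,1,2,\dots$) is finite, with the topology given by these norms, and let $Z=\bigcup_{a>0}Z(a)$ with the locally convex inductive limit topology. The Fourier transform is $F(\xi)(z)=\int_{\mathbb R^n}\xi(x)e^{i\sum_jx_jz_j}\,dx$, with $z\in\mathbb C^n$ for $\xi\in\mathscr D_a$ or $\xi\in\mathscr D$, and $z\in\mathbb R^n$ for $\xi\in\mathscr S$. The image $F(\mathscr D_a)\subset Z(a)$ carries the subspace topology of $Z(a)$, $F(\mathscr D)$ that of $Z$, and $F(\mathscr S)$ that of $\mathscr S$. **Theorem.** Let $n\ge0$, $E\in\{\mathscr D_a\ (a>0),\mathscr D,\mathscr S\}$ and $\gamma\in C(0)$. The map $F:E\to F(E)$ is bijective, with $F(\mathscr D)=Z$ and $F(\mathscr S)=\mathscr S$. Let $U\in\mathcal N(E)$. Then $F(U)\in\mathcal N(F(E))$. For $f:E\to\mathbb C$ let $F(f):F(E)\to\mathbb C$, $F(f)(\zeta)=(2\pi)^nf(F^{-1}(\zeta))$, that is, $F(f)(F(\xi))=(2\pi)^nf(\xi)$ for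 all $\xi\in E$. Then: 1. $f\mapsto F(f)$ maps $E^{(\gamma,U)}$ bijectively onto $(F(E))^{(\gamma,F(U))}$. 2. If $\alpha_1,\dots,\alpha_m\in\mathbb C$ and $f_1,\dots,f_m\in E^{(\gamma,U)}$, then $F\bigl(\sum_k\alpha_kf_k\bigr)=\sum_k\alpha_kF(f_k)\in[(F(E))^{(\gamma,F(U))}]$. Moreover $f\mapsto F(f)$ maps $[E^{(\gamma,U)}]$ bijectively onto $[(F(E))^{(\gamma,F(U))}]$, and $F:[E^{(\gamma,U)}]\to[(F(E))^{(\gamma,F(U))}]$ is linear and $w*$–$w*$ continuous. -/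

import Mathlib

open Filter Topology MeasureTheory Function
open scoped SchwartzMap ContDiff FourierTransform

/-! ### Demi-linear maps and demi-distributions -/

/-- The class `C(0)` of functions `γ : ℂ → ℂ` with `lim_{t → 0} γ(t) = γ(0) = 0` and
`|γ(t)| ≥ |t|` for `|t| ≤ 1`. -/
def CZero : Set (ℂ → ℂ) :=
  {γ | Tendsto γ (𝓝 0) (𝓝 0) ∧ γ 0 = 0 ∧ ∀ t : ℂ, ‖t‖ ≤ 1 → ‖t‖ ≤ ‖γ t‖}

/-- The family `𝓛_{γ,U}(X, Y)` of demi-linear maps related to `γ` and `U`. -/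
def DemiLinear {X Y : Type*} [AddCommGroup X] [Module ℂ X] [AddCommGroup Y] [Module ℂ Y]
    (γ : ℂ → ℂ) (U : Set X) : Set (X → Y) :=
  {f | f 0 = 0 ∧ ∀ x : X, ∀ u ∈ U, ∀ t : ℂ, ‖t‖ ≤ 1 →
    ∃ r s : ℂ, ‖r - 1‖ ≤ ‖γ t‖ ∧ ‖s‖ ≤ ‖γ t‖ ∧ f (x + t • u) = r • f x + s • f u}

/-- `X^{(γ,U)}`: the continuous functionals on `X` belonging to `𝓛_{γ,U}(X, ℂ)`. -/
def DemiDist {X : Type*} [AddCommGroup X] [Module ℂ X] [TopologicalSpace X]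
    (γ : ℂ → ℂ) (U : Set X) : Set (X → ℂ) :=
  {f | Continuous f ∧ f ∈ DemiLinear γ U}

/-- `[X^{(γ,U)}]`: the linear span of `X^{(γ,U)}` in `ℂ^X`. As a subtype of `X → ℂ` it carries the
topology of pointwise convergence, that is, the `w*` topology. -/
abbrev DemiDistSpan {X : Type*} [AddCommGroup X] [Module ℂ X] [TopologicalSpace X]
    (γ : ℂ → ℂ) (U : Set X) : Submodule ℂ (X → ℂ) :=
  Submodule.span ℂ (DemiDist γ U)

/-! ### The spaces of test functions on `ℝⁿ` -/

/-- The closed Euclidean ball of radius `a` in `ℝⁿ`, as a compact set. -/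
noncomputable def ballCompact (n : ℕ) (a : ℝ) : TopologicalSpace.Compacts (EuclideanSpace ℝ (Fin n)) :=
  ⟨Metric.closedBall 0 a, isCompact_closedBall 0 a⟩

/-- `𝓓_a`: the smooth functions `ℝⁿ → ℂ` vanishing at all `x` with `|x| > a`, with the topology of
uniform convergence of all derivatives. -/
abbrev TestDa (n : ℕ) (a : ℝ) : Type :=
  ContDiffMapSupportedIn (EuclideanSpace ℝ (Fin n)) ℂ ⊤ (ballCompact n a)

/-- `𝓓`: the smooth compactly supported functions `ℝⁿ → ℂ`, with the canonical LF topology. -/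
abbrev TestD (n : ℕ) : Type :=
  TestFunction (⊤ : TopologicalSpace.Opens (EuclideanSpace ℝ (Fin n))) ℂ ⊤

/-- `𝓢`: the Schwartz space of `ℝⁿ`. -/
abbrev TestS (n : ℕ) : Type := 𝓢(EuclideanSpace ℝ (Fin n), ℂ)

/-! ### The spaces `Z(a)` and `Z` of entire functions on `ℂⁿ` -/

/-- `|y| = |y₁| + ⋯ + |yₙ|` where `z = x + iy ∈ ℂⁿ`. -/
def imNorm {n : ℕ} (z : Fin n → ℂ) : ℝ := ∑ j, |(z j).im|

/-- The monomial `z^α = ∏ zₖ^{αₖ}` for a multi-index `α`. -/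
def monom {n : ℕ} (α : Fin n → ℕ) (z : Fin n → ℂ) : ℂ := ∏ k, z k ^ α k

/-- The entire functions `ζ` on `ℂⁿ` such that for each multi-index `α` there is a constant `C`
with `|z^α ζ(z)| ≤ C e^{a|y|}` for all `z = x + iy`. -/
def zSubmodule (n : ℕ) (a : ℝ) : Submodule ℂ ((Fin n → ℂ) → ℂ) where
  carrier := {ζ | Differentiable ℂ ζ ∧
    ∀ α : Fin n → ℕ, ∃ C : ℝ, ∀ z, ‖monom α z * ζ z‖ ≤ C * Real.exp (a * imNorm z)}
  zero_mem' := ⟨differentiable_const _, fun α => ⟨0, fun z => by simp⟩⟩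
  add_mem' := by
    rintro f g ⟨hf, hf'⟩ ⟨hg, hg'⟩
    refine ⟨hf.add hg, fun α => ?_⟩
    obtain ⟨C, hC⟩ := hf' α
    obtain ⟨D, hD⟩ := hg' α
    refine ⟨C + D, fun z => ?_⟩
    rw [Pi.add_apply, mul_add, add_mul]
    exact (norm_add_le _ _).trans (add_le_add (hC z) (hD z))
  smul_mem' := by
    rintro c f ⟨hf, hf'⟩
    refine ⟨hf.const_smul c, fun α => ?_⟩
    obtain ⟨C, hC⟩ := hf' α
    refine ⟨‖c‖ * C, fun z => ?_⟩
    rw [Pi.smul_apply, smul_eq_mul, mul_left_comm, norm_mul, mul_assoc]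
    exact mul_le_mul_of_nonneg_left (hC z) (norm_nonneg c)

lemma zSubmodule_mono {n : ℕ} {a b : ℝ} (hab : a ≤ b) : zSubmodule n a ≤ zSubmodule n b := by
  rintro f ⟨hf, hf'⟩
  refine ⟨hf, fun α => ?_⟩
  obtain ⟨C, hC⟩ := hf' α
  refine ⟨|C|, fun z => (hC z).trans ?_⟩
  have h0 : 0 ≤ imNorm z := Finset.sum_nonneg fun j _ => abs_nonneg _
  exact mul_le_mul (le_abs_self C) (Real.exp_le_exp.2 (mul_le_mul_of_nonneg_right hab h0))
    (Real.exp_nonneg _) (abs_nonneg C)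

/-- The space `Z(a)`. A type of its own, so that it does not inherit the topology of pointwise
convergence. -/
def ZSpace (n : ℕ) (a : ℝ) : Type := zSubmodule n a

noncomputable instance (n : ℕ) (a : ℝ) : AddCommGroup (ZSpace n a) :=
  inferInstanceAs (AddCommGroup (zSubmodule n a))

noncomputable instance (n : ℕ) (a : ℝ) : Module ℂ (ZSpace n a) :=
  inferInstanceAs (Module ℂ (zSubmodule n a))

instance (n : ℕ) (a : ℝ) : CoeFun (ZSpace n a) (fun _ => (Fin n → ℂ) → ℂ) := ⟨Subtype.val⟩

lemma ZSpace.bddAbove {n : ℕ} {a : ℝ} (α : Fin n → ℕ) (ζ : ZSpace n a) :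
    BddAbove (Set.range fun z => ‖monom α z * ζ z‖ * Real.exp (-(a * imNorm z))) := by
  obtain ⟨C, hC⟩ := ζ.2.2 α
  refine ⟨C, ?_⟩
  rintro _ ⟨z, rfl⟩
  have := mul_le_mul_of_nonneg_right (hC z) (Real.exp_nonneg (-(a * imNorm z)))
  rwa [mul_assoc, ← Real.exp_add, add_neg_cancel, Real.exp_zero, mul_one] at this

/-- The seminorm `ζ ↦ sup_z |z^α ζ(z)| e^{-a|y|}` on `Z(a)`. -/
noncomputable def zSeminormAux (n : ℕ) (a : ℝ) (α : Fin n → ℕ) : Seminorm ℂ (ZSpace n a) :=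
  Seminorm.of (fun ζ => ⨆ z, ‖monom α z * ζ z‖ * Real.exp (-(a * imNorm z)))
    (by
      intro f g
      refine ciSup_le fun z => ?_
      refine le_trans ?_ (add_le_add (le_ciSup (ZSpace.bddAbove α f) z)
        (le_ciSup (ZSpace.bddAbove α g) z))
      rw [← add_mul]
      refine mul_le_mul_of_nonneg_right ?_ (Real.exp_nonneg _)
      change ‖monom α z * (f z + g z)‖ ≤ _
      rw [mul_add]
      exact norm_add_le _ _)
    (by
      intro c f
      rw [Real.mul_iSup_of_nonneg (norm_nonneg c)]
      refine iSup_congr fun z => ?_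
      change ‖monom α z * (c * f z)‖ * _ = _
      rw [mul_left_comm, norm_mul, mul_assoc])

/-- The multi-indices `α` with `|α| ≤ p`. -/
def multiIndices (n p : ℕ) : Finset (Fin n → ℕ) :=
  (Fintype.piFinset fun _ => Finset.range (p + 1)).filter fun α => ∑ j, α j ≤ p

/-- The norms `‖ζ‖_p = sup_{z, |α| ≤ p} |z^α ζ(z)| e^{-a|y|}` on `Z(a)`. -/
noncomputable def zNorm (n : ℕ) (a : ℝ) (p : ℕ) : Seminorm ℂ (ZSpace n a) :=
  (multiIndices n p).sup (zSeminormAux n a)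

/-- The topology of `Z(a)`, given by the sequence of norms `‖·‖_p`. -/
noncomputable instance (n : ℕ) (a : ℝ) : TopologicalSpace (ZSpace n a) :=
  SeminormFamily.moduleFilterBasis (𝕜 := ℂ) (zNorm n a) |>.topology

lemma zNorm_withSeminorms (n : ℕ) (a : ℝ) : WithSeminorms (𝕜 := ℂ) (zNorm n a) := ⟨rfl⟩

/-- The union of the `Z(a)`, `a > 0`. -/
def zUnion (n : ℕ) : Submodule ℂ ((Fin n → ℂ) → ℂ) where
  carrier := {ζ | ∃ a : ℝ, 0 < a ∧ ζ ∈ zSubmodule n a}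
  zero_mem' := ⟨1, one_pos, Submodule.zero_mem _⟩
  add_mem' := by
    rintro f g ⟨a, ha, hf⟩ ⟨b, _, hg⟩
    exact ⟨max a b, lt_max_of_lt_left ha, Submodule.add_mem _
      (zSubmodule_mono (le_max_left a b) hf) (zSubmodule_mono (le_max_right a b) hg)⟩
  smul_mem' := by
    rintro c f ⟨a, ha, hf⟩
    exact ⟨a, ha, Submodule.smul_mem _ c hf⟩

/-- The space `Z`. -/
def ZLim (n : ℕ) : Type := zUnion n

noncomputable instance (n : ℕ) : AddCommGroup (ZLim n) :=
  inferInstanceAs (AddCommGroup (zUnion n))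

noncomputable instance (n : ℕ) : Module ℂ (ZLim n) :=
  inferInstanceAs (Module ℂ (zUnion n))

instance (n : ℕ) : CoeFun (ZLim n) (fun _ => (Fin n → ℂ) → ℂ) := ⟨Subtype.val⟩

/-- The inclusion `Z(a) → Z`. -/
noncomputable def ZSpace.toZLim {n : ℕ} {a : ℝ} (ha : 0 < a) (ζ : ZSpace n a) : ZLim n := ⟨ζ.1, a, ha, ζ.2⟩

/-- The topology of `Z`: the locally convex inductive limit of the `Z(a)`, that is, the finest
locally convex vector space topology for which all inclusions `Z(a) → Z` are continuous. -/
noncomputable instance (n : ℕ) : TopologicalSpace (ZLim n) :=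
  sInf {t : TopologicalSpace (ZLim n) |
    (∀ (a : ℝ) (ha : 0 < a),
      TopologicalSpace.coinduced (ZSpace.toZLim (n := n) ha) inferInstance ≤ t) ∧
    @IsTopologicalAddGroup (ZLim n) t _ ∧
    @ContinuousSMul ℝ (ZLim n) _ _ t ∧
    @LocallyConvexSpace ℝ (ZLim n) _ _ _ _ t}

/-! ### The Fourier transform of test functions -/

/-- `F(ξ)(z) = ∫ ξ(x) e^{i(x,z)} dx` with `(x,z) = ∑ xⱼ zⱼ`, so that
`e^{i(x,σ+iτ)} = e^{i(x,σ)-(x,τ)}`. -/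
noncomputable def fourierInt {n : ℕ} (ξ : EuclideanSpace ℝ (Fin n) → ℂ) (z : Fin n → ℂ) : ℂ :=
  ∫ x, ξ x * Complex.exp (Complex.I * ∑ j, (x j : ℂ) * z j)

/-- Auxiliary: smooth functions vanishing outside the closed ball of radius `a`. -/
def SmoothIn (n : ℕ) (a : ℝ) (f : EuclideanSpace ℝ (Fin n) → ℂ) : Prop :=
  ContDiff ℝ ∞ f ∧ ∀ x, a < ‖x‖ → f x = 0

lemma SmoothIn.hasCompactSupport {n : ℕ} {a : ℝ} {f : EuclideanSpace ℝ (Fin n) → ℂ}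
    (hf : SmoothIn n a f) : HasCompactSupport f :=
  HasCompactSupport.intro (isCompact_closedBall 0 a) fun x hx => hf.2 x (by simpa using hx)

lemma continuous_kernel {n : ℕ} (z : Fin n → ℂ) :
    Continuous fun x : EuclideanSpace ℝ (Fin n) =>
      Complex.exp (Complex.I * ∑ j, (x j : ℂ) * z j) := by
  fun_prop

lemma SmoothIn.integrable {n : ℕ} {a : ℝ} {f : EuclideanSpace ℝ (Fin n) → ℂ}
    (hf : SmoothIn n a f) (g : EuclideanSpace ℝ (Fin n) → ℂ) (hg : Continuous g) :
    Integrable fun x => f x * g x :=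
  (hf.1.continuous.mul hg).integrable_of_hasCompactSupport hf.hasCompactSupport.mul_right

lemma norm_kernel_le {n : ℕ} {a : ℝ} (x : EuclideanSpace ℝ (Fin n)) (hx : ‖x‖ ≤ a)
    (z : Fin n → ℂ) :
    ‖Complex.exp (Complex.I * ∑ j, (x j : ℂ) * z j)‖ ≤ Real.exp (a * imNorm z) := by
  rw [Complex.norm_exp]
  refine Real.exp_le_exp.2 ?_
  have h1 : (Complex.I * ∑ j, (x j : ℂ) * z j).re = ∑ j, -(x j * (z j).im) := by
    simp [Complex.mul_re, Complex.mul_im]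
  rw [h1, imNorm, Finset.mul_sum]
  refine Finset.sum_le_sum fun j _ => ?_
  have h2 : |x j| ≤ a := by
    exact (PiLp.norm_apply_le x j).trans hx
  calc -(x j * (z j).im) ≤ |x j * (z j).im| := neg_le_abs _
    _ = |x j| * |(z j).im| := abs_mul _ _
    _ ≤ a * |(z j).im| := mul_le_mul_of_nonneg_right h2 (abs_nonneg _)

lemma SmoothIn.norm_fourierInt_le {n : ℕ} {a : ℝ} {f : EuclideanSpace ℝ (Fin n) → ℂ}
    (hf : SmoothIn n a f) (z : Fin n → ℂ) :
    ‖fourierInt f z‖ ≤ (∫ x, ‖f x‖) * Real.exp (a * imNorm z) := by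
  rw [← integral_mul_const]
  refine norm_integral_le_of_norm_le ?_ (Eventually.of_forall fun x => ?_)
  · have := (hf.integrable (fun _ => 1) continuous_const).norm
    simp only [mul_one] at this
    exact this.mul_const _
  · rw [norm_mul]
    by_cases hx : a < ‖x‖
    · simp [hf.2 x hx]
    · exact mul_le_mul_of_nonneg_left (norm_kernel_le x (not_lt.1 hx) z) (norm_nonneg _)

/-- Auxiliary: the linear form `w ↦ i ∑ xⱼ wⱼ` on `ℂⁿ`. -/
noncomputable def phaseForm {n : ℕ} (x : EuclideanSpace ℝ (Fin n)) : (Fin n → ℂ) →L[ℂ] ℂ :=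
  Complex.I • ∑ j, (x j : ℂ) • ContinuousLinearMap.proj j

lemma phaseForm_apply {n : ℕ} (x : EuclideanSpace ℝ (Fin n)) (z : Fin n → ℂ) :
    phaseForm x z = Complex.I * ∑ j, (x j : ℂ) * z j := by
  simp [phaseForm]

lemma SmoothIn.differentiable {n : ℕ} {a : ℝ} {f : EuclideanSpace ℝ (Fin n) → ℂ}
    (hf : SmoothIn n a f) : Differentiable ℂ (fourierInt f) := by
  intro z₀
  have hcont : Continuous (phaseForm : EuclideanSpace ℝ (Fin n) → _) := by
    unfold phaseForm; fun_prop
  have hg (z : Fin n → ℂ) : Continuous fun x : EuclideanSpace ℝ (Fin n) =>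
      Complex.exp (phaseForm x z) := by
    simp only [phaseForm_apply]; exact continuous_kernel z
  have hM : ∃ M : ℝ, 0 ≤ M ∧ ∀ x : EuclideanSpace ℝ (Fin n), ‖x‖ ≤ a → ‖phaseForm x‖ ≤ M := by
    obtain ⟨M, hM⟩ := (isCompact_closedBall (0 : EuclideanSpace ℝ (Fin n)) a).exists_bound_of_continuousOn
      hcont.continuousOn
    exact ⟨|M|, abs_nonneg _, fun x hx => (hM x (by simpa using hx)).trans (le_abs_self M)⟩
  obtain ⟨M, hM0, hM⟩ := hM
  have key := hasFDerivAt_integral_of_dominated_of_fderiv_le (𝕜 := ℂ)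
    (μ := (volume : Measure (EuclideanSpace ℝ (Fin n))))
    (F := fun z x => f x * Complex.exp (phaseForm x z))
    (F' := fun z x => f x • (Complex.exp (phaseForm x z) • phaseForm x))
    (x₀ := z₀) (s := Metric.ball z₀ 1)
    (bound := fun x => ‖f x‖ * (Real.exp (M * (‖z₀‖ + 1)) * M))
    (Metric.ball_mem_nhds z₀ one_pos)
    (Eventually.of_forall fun z => (hf.integrable _ (hg z)).aestronglyMeasurable)
    (hf.integrable _ (hg z₀))
    ((hf.1.continuous.smul ((hg z₀).smul hcont)).aestronglyMeasurable)
    (Eventually.of_forall fun x z hz => by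
      rw [norm_smul, norm_smul]
      by_cases hx : a < ‖x‖
      · simp [hf.2 x hx]
      · have hx' := hM x (not_lt.1 hx)
        refine mul_le_mul_of_nonneg_left (mul_le_mul ?_ hx' (norm_nonneg _)
          (Real.exp_nonneg _)) (norm_nonneg _)
        refine (Complex.norm_exp_le_exp_norm _).trans (Real.exp_le_exp.2 ?_)
        refine ((phaseForm x).le_opNorm z).trans (mul_le_mul hx' ?_ (norm_nonneg _) hM0)
        have : ‖z - z₀‖ < 1 := by simpa [dist_eq_norm] using hz
        have h3 := norm_add_le (z - z₀) z₀
        rw [sub_add_cancel] at h3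
        linarith)
    (by
      have := (hf.integrable (fun _ => 1) continuous_const).norm
      simp only [mul_one] at this
      exact this.mul_const _)
    (Eventually.of_forall fun x z _ => by
      have := ((phaseForm x).hasFDerivAt (x := z)).cexp
      exact this.const_mul (f x))
  have heq : fourierInt f = fun z => ∫ x, f x * Complex.exp (phaseForm x z) := by
    funext z; simp only [fourierInt, phaseForm_apply]
  rw [heq]
  exact key.differentiableAt

/-- Multiplying `F(f)` by a coordinate amounts to differentiating `f`. -/
lemma SmoothIn.coord_mul {n : ℕ} {a : ℝ} {f : EuclideanSpace ℝ (Fin n) → ℂ}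
    (hf : SmoothIn n a f) (k : Fin n) :
    ∃ g, SmoothIn n a g ∧ ∀ z, z k * fourierInt f z = fourierInt g z := by
  set v : EuclideanSpace ℝ (Fin n) := EuclideanSpace.single k 1 with hv
  have hsm : ContDiff ℝ ∞ fun x => fderiv ℝ f x v :=
    (hf.1.fderiv_right (m := ∞) (by simp)).clm_apply contDiff_const
  have hD : SmoothIn n a fun x => fderiv ℝ f x v := by
    refine ⟨hsm, fun x hx => ?_⟩
    have : f =ᶠ[𝓝 x] fun _ => 0 := by
      filter_upwards [(isOpen_lt continuous_const continuous_norm).mem_nhds hx] with y hy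
      exact hf.2 y hy
    simp [this.fderiv_eq]
  refine ⟨fun x => Complex.I * fderiv ℝ f x v,
    ⟨contDiff_const.mul hsm, fun x hx => by simp [hD.2 x hx]⟩, fun z => ?_⟩
  set e : EuclideanSpace ℝ (Fin n) → ℂ :=
    fun x => Complex.exp (Complex.I * ∑ j, (x j : ℂ) * z j) with he
  have hlin : ∀ x, HasFDerivAt
      (fun x : EuclideanSpace ℝ (Fin n) => Complex.I * ∑ j, (x j : ℂ) * z j)
      (Complex.I • ∑ j, (z j) • (Complex.ofRealCLM.comp
        (EuclideanSpace.proj (𝕜 := ℝ) j))) x := by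
    intro x
    have h : (fun x : EuclideanSpace ℝ (Fin n) => Complex.I * ∑ j, (x j : ℂ) * z j)
        = ⇑(Complex.I • ∑ j, (z j) • (Complex.ofRealCLM.comp
        (EuclideanSpace.proj (𝕜 := ℝ) j) : EuclideanSpace ℝ (Fin n) →L[ℝ] ℂ)) := by
      funext y; simp [mul_comm]
    rw [h]
    exact ContinuousLinearMap.hasFDerivAt _
  have hde : ∀ x, HasFDerivAt e (e x • (Complex.I • ∑ j, (z j) • (Complex.ofRealCLM.comp
        (EuclideanSpace.proj (𝕜 := ℝ) j)))) x := fun x => (hlin x).cexp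
  have hdev : ∀ x, fderiv ℝ e x v = Complex.I * z k * e x := by
    intro x
    rw [(hde x).fderiv]
    have : ∑ j, z j * ((if j = k then (1 : ℝ) else 0 : ℝ) : ℂ) = z k := by
      rw [Finset.sum_eq_single k] <;> simp +contextual
    simp [hv, this]
    ring
  have hce : Continuous e := continuous_kernel z
  have hparts := integral_mul_fderiv_eq_neg_fderiv_mul_of_integrable
    (μ := (volume : Measure (EuclideanSpace ℝ (Fin n)))) (𝕜 := ℂ) (f := f) (g := e) (v := v)
    (hD.integrable e hce)
    (by simp only [hdev]; exact hf.integrable _ (continuous_const.mul hce))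
    (hf.integrable e hce)
    (fun x _ => hf.1.differentiable (by simp) x)
    (fun x _ => (hde x).differentiableAt)
  simp only [hdev] at hparts
  have h1 : ∫ x, f x * (Complex.I * z k * e x) = Complex.I * z k * fourierInt f z := by
    rw [fourierInt, ← integral_const_mul]
    congr 1; funext x; ring
  have h2 : fourierInt (fun x => Complex.I * fderiv ℝ f x v) z
      = Complex.I * ∫ x, fderiv ℝ f x v * e x := by
    rw [fourierInt, ← integral_const_mul]
    congr 1; funext x; rw [mul_assoc]
  rw [h1] at hparts
  rw [h2, ← neg_eq_iff_eq_neg.2 hparts]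
  linear_combination (z k * fourierInt f z) * Complex.I_mul_I

lemma SmoothIn.monom_mul {n : ℕ} {a : ℝ} {f : EuclideanSpace ℝ (Fin n) → ℂ}
    (hf : SmoothIn n a f) (α : Fin n → ℕ) :
    ∃ g, SmoothIn n a g ∧ ∀ z, monom α z * fourierInt f z = fourierInt g z := by
  have hpow : ∀ (k : Fin n) (m : ℕ) (f : EuclideanSpace ℝ (Fin n) → ℂ), SmoothIn n a f →
      ∃ g, SmoothIn n a g ∧ ∀ z, z k ^ m * fourierInt f z = fourierInt g z := by
    intro k m
    induction m with
    | zero => exact fun f hf => ⟨f, hf, fun z => by simp⟩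
    | succ m ih =>
      intro f hf
      obtain ⟨g, hg, hg'⟩ := hf.coord_mul k
      obtain ⟨h, hh, hh'⟩ := ih g hg
      exact ⟨h, hh, fun z => by rw [pow_succ, mul_assoc, hg', hh']⟩
  have hprod : ∀ s : Finset (Fin n), ∃ g, SmoothIn n a g ∧
      ∀ z, (∏ k ∈ s, z k ^ α k) * fourierInt f z = fourierInt g z := by
    intro s
    induction s using Finset.induction_on with
    | empty => exact ⟨f, hf, fun z => by simp⟩
    | insert k s hk ih =>
      obtain ⟨g, hg, hg'⟩ := ih
      obtain ⟨h, hh, hh'⟩ := hpow k (α k) g hg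
      exact ⟨h, hh, fun z => by rw [Finset.prod_insert hk, mul_assoc, hg', hh']⟩
  exact hprod Finset.univ

lemma SmoothIn.fourierInt_mem {n : ℕ} {a : ℝ} {f : EuclideanSpace ℝ (Fin n) → ℂ}
    (hf : SmoothIn n a f) : fourierInt f ∈ zSubmodule n a := by
  refine ⟨hf.differentiable, fun α => ?_⟩
  obtain ⟨g, hg, hg'⟩ := hf.monom_mul α
  exact ⟨_, fun z => by rw [hg']; exact hg.norm_fourierInt_le z⟩

lemma SmoothIn.fourierInt_add {n : ℕ} {a b : ℝ} {f g : EuclideanSpace ℝ (Fin n) → ℂ}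
    (hf : SmoothIn n a f) (hg : SmoothIn n b g) :
    fourierInt (fun x => f x + g x) = fun z => fourierInt f z + fourierInt g z := by
  funext z
  simp only [fourierInt, add_mul]
  exact integral_add (hf.integrable _ (continuous_kernel z)) (hg.integrable _ (continuous_kernel z))

lemma fourierInt_smul {n : ℕ} (c : ℂ) (f : EuclideanSpace ℝ (Fin n) → ℂ) :
    fourierInt (fun x => c * f x) = fun z => c * fourierInt f z := by
  funext z
  simp only [fourierInt, mul_assoc, integral_const_mul]

lemma TestDa.smoothIn {n : ℕ} {a : ℝ} (ξ : TestDa n a) : SmoothIn n a ξ :=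
  ⟨ξ.contDiff, fun x hx => ξ.zero_on_compl (by
    change x ∉ Metric.closedBall (0 : EuclideanSpace ℝ (Fin n)) a
    simpa using hx)⟩

lemma TestD.smoothIn {n : ℕ} (ξ : TestD n) : ∃ a : ℝ, 0 < a ∧ SmoothIn n a ξ := by
  obtain ⟨a, ha⟩ := ξ.hasCompactSupport.isCompact.isBounded.subset_closedBall 0
  refine ⟨max a 1, lt_max_of_lt_right one_pos, ξ.contDiff, fun x hx => ?_⟩
  by_contra h
  have := ha (subset_tsupport _ h)
  rw [mem_closedBall_zero_iff] at this
  exact absurd (lt_of_le_of_lt (le_max_left a 1) hx) (not_lt.2 this)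

/-- The Fourier transform `𝓓_a → Z(a)`. -/
noncomputable def fourierDaZ (n : ℕ) (a : ℝ) : TestDa n a →ₗ[ℂ] ZSpace n a where
  toFun ξ := ⟨fourierInt ξ, ξ.smoothIn.fourierInt_mem⟩
  map_add' ξ η := Subtype.ext (ξ.smoothIn.fourierInt_add η.smoothIn)
  map_smul' c ξ := Subtype.ext (fourierInt_smul c ξ)

/-- `F(𝓓_a)`, the image of `𝓓_a` under the Fourier transform, with the topology given by the
norms `‖·‖_p` of `Z(a)`. -/
noncomputable abbrev FTestDa (n : ℕ) (a : ℝ) : Submodule ℂ (ZSpace n a) := LinearMap.range (fourierDaZ n a)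

/-- The Fourier transform `F : 𝓓_a → F(𝓓_a)`. -/
noncomputable def fourierDa (n : ℕ) (a : ℝ) : TestDa n a →ₗ[ℂ] FTestDa n a :=
  (fourierDaZ n a).rangeRestrict

/-- The Fourier transform `F : 𝓓 → Z`. -/
noncomputable def fourierD (n : ℕ) : TestD n →ₗ[ℂ] ZLim n where
  toFun ξ := ⟨fourierInt ξ, by
    obtain ⟨a, ha, h⟩ := ξ.smoothIn
    exact ⟨a, ha, h.fourierInt_mem⟩⟩
  map_add' ξ η := by
    obtain ⟨a, _, h⟩ := ξ.smoothIn
    obtain ⟨b, _, h'⟩ := η.smoothIn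
    exact Subtype.ext (h.fourierInt_add h')
  map_smul' c ξ := Subtype.ext (fourierInt_smul c ξ)

/-- Auxiliary: Mathlib's Fourier transform of `ξ`, evaluated at `-σ / (2π)`. -/
noncomputable def fourierSAux (n : ℕ) : TestS n →L[ℂ] TestS n :=
  (SchwartzMap.compCLMOfContinuousLinearEquiv ℂ
    (ContinuousLinearEquiv.smulLeft (R₁ := ℝ) (M₁ := EuclideanSpace ℝ (Fin n))
      (Units.mk0 (-(2 * Real.pi)⁻¹) (by simp [Real.pi_ne_zero])))).comp
    (FourierTransform.fourierCLM ℂ (TestS n))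

lemma fourierSAux_apply (n : ℕ) (ξ : TestS n) (σ : EuclideanSpace ℝ (Fin n)) :
    fourierSAux n ξ σ = fourierInt ξ (fun j => (σ j : ℂ)) := by
  change 𝓕 (ξ : EuclideanSpace ℝ (Fin n) → ℂ) ((-(2 * Real.pi)⁻¹ : ℝ) • σ) = _
  rw [Real.fourier_eq', fourierInt]
  congr 1
  funext x
  rw [smul_eq_mul, mul_comm]
  congr 2
  rw [inner_smul_right, PiLp.inner_apply]
  have : (-2 * Real.pi * (-(2 * Real.pi)⁻¹ * ∑ i, inner ℝ (x i) (σ i)) : ℝ)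
      = ∑ i, inner ℝ (x i) (σ i) := by
    field_simp
  rw [this, mul_comm]
  simp [mul_comm]

/-- The Fourier transform `F : 𝓢 → 𝓢`, `F(ξ)(σ) = ∫ ξ(x) e^{i(x,σ)} dx` for `σ ∈ ℝⁿ`. -/
noncomputable def fourierS (n : ℕ) : TestS n →ₗ[ℂ] TestS n where
  toFun ξ :=
    { toFun := fun σ => fourierInt ξ (fun j => (σ j : ℂ))
      smooth' := by
        simp only [← fourierSAux_apply]; exact (fourierSAux n ξ).smooth'
      decay' := by
        simp only [← fourierSAux_apply]; exact (fourierSAux n ξ).decay' }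
  map_add' ξ η := by
    ext σ
    change fourierInt (ξ + η) _ = fourierInt ξ _ + fourierInt η _
    simp only [← fourierSAux_apply, map_add]; rfl
  map_smul' c ξ := by
    ext σ
    exact congrFun (fourierInt_smul c ξ) _

/-! ### The Fourier transform of functionals -/

/-- For a bijective linear map `F : E → F(E)` and `f : E → ℂ`, the function
`F(f) : F(E) → ℂ`, `F(f)(ζ) = (2π)ⁿ f(F⁻¹(ζ))`. -/
noncomputable def fourierFunctional (n : ℕ) {E G : Type*} [AddCommGroup E] [Module ℂ E]
    [AddCommGroup G] [Module ℂ G] (F : E →ₗ[ℂ] G) (f : E → ℂ) : G → ℂ :=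
  fun ζ => (2 * (Real.pi : ℂ)) ^ n * f (invFun F ζ)

/-! ### Transport of functionals along a linear homeomorphism -/

section Transport

variable {E G : Type*} [AddCommGroup E] [Module ℂ E] [AddCommGroup G] [Module ℂ G]

/-! Everything follows once `F` is a linear homeomorphism onto its image. The map `f ↦ (2π)ⁿ f ∘
F⁻¹` is then a linear bijection between all functions on the two spaces. The relation `f (x + t u) =
r f x + s f u` is homogeneous in `f`, so it survives the scalar with the same `r` and `s`, and
continuity passes along a homeomorphism. Evaluating `F(f)` at `ζ` is a multiple of evaluating `f` at
`F⁻¹ ζ`, which gives `w*` continuity. This is `fourierFunctional_of_isHomeomorph`.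

The analysis lies in the three homeomorphisms. On `𝓢`, `F` is the standard Fourier transform
followed by a dilation. On functions supported in a ball, integration by parts turns bounds on
derivatives into bounds on `z^α F(ξ)(z)`, so `F` is continuous into `Z(a)`. Conversely, the decay of
`ζ` on `ℝⁿ` bounds every derivative of its inverse transform by the norms of `Z(a)`, so `F⁻¹` is
continuous for the topology induced from `Z(a)`. For `𝓓_a` this suffices, because the image is by
definition the range of `F`.

For `𝓓` surjectivity onto `Z` is needed, a Paley–Wiener argument: shifting the contour in one
coordinate (`ZSpace.inv_eq_zero`) shows that the inverse transform of `ζ ∈ Z(a)` vanishes when some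
`|x j| ≥ a`. Its transform agrees with `ζ` on `ℝⁿ` by Fourier inversion, hence on `ℂⁿ` since both
are entire (`ZSpace.fourierInt_inv`). The universal properties of the two inductive limits then
reduce continuity in both directions to the steps `𝓓_K → Z(a)` and `Z(a) → 𝓓_{na}`. -/

lemma two_pi_pow_ne_zero (n : ℕ) : (2 * (Real.pi : ℂ)) ^ n ≠ 0 := by
  simp [Real.pi_ne_zero]

lemma fourierFunctional_apply (n : ℕ) {F : E →ₗ[ℂ] G} (hF : Injective F) (f : E → ℂ) (ξ : E) :
    fourierFunctional n F f (F ξ) = (2 * (Real.pi : ℂ)) ^ n * f ξ := by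
  rw [fourierFunctional, leftInverse_invFun hF ξ]

/-- The map `f ↦ F(f)` as a linear map on all functions. -/
noncomputable def fourierFunctionalLM (n : ℕ) (F : E →ₗ[ℂ] G) : (E → ℂ) →ₗ[ℂ] (G → ℂ) where
  toFun := fourierFunctional n F
  map_add' f g := by funext ζ; simp [fourierFunctional, mul_add]
  map_smul' c f := by
    funext ζ
    simp only [fourierFunctional, Pi.smul_apply, smul_eq_mul, RingHom.id_apply]
    ring

lemma fourierFunctional_injective (n : ℕ) {F : E →ₗ[ℂ] G} (hF : Injective F) :
    Injective (fourierFunctional n F) := by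
  intro f g h
  funext ξ
  have := congrFun h (F ξ)
  rw [fourierFunctional_apply n hF, fourierFunctional_apply n hF] at this
  exact mul_left_cancel₀ (two_pi_pow_ne_zero n) this

lemma fourierFunctional_surjective (n : ℕ) {F : E →ₗ[ℂ] G} (hF : Bijective F) :
    Surjective (fourierFunctional n F) := by
  intro g
  refine ⟨fun ξ => ((2 * (Real.pi : ℂ)) ^ n)⁻¹ * g (F ξ), ?_⟩
  funext ζ
  obtain ⟨ξ, rfl⟩ := hF.2 ζ
  rw [fourierFunctional_apply n hF.1, mul_inv_cancel_left₀ (two_pi_pow_ne_zero n)]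

variable [TopologicalSpace E] [TopologicalSpace G]

/-- The same `r` and `s` witness both sides: the relation is homogeneous in the functional, and `F`
is linear and carries `U` to its image. -/
lemma fourierFunctional_mem_demiDist_iff (n : ℕ) {F : E →ₗ[ℂ] G} (hF : IsHomeomorph F)
    (γ : ℂ → ℂ) (U : Set E) (f : E → ℂ) :
    fourierFunctional n F f ∈ DemiDist γ (F '' U) ↔ f ∈ DemiDist γ U := by
  have hc := two_pi_pow_ne_zero n
  have hinj := hF.injective
  have hval := fourierFunctional_apply n hinj f
  refine and_congr ?_ (and_congr ?_ ?_)
  · have : fourierFunctional n F f ∘ F = fun ξ => (2 * (Real.pi : ℂ)) ^ n * f ξ :=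
      funext hval
    -- A homeomorphism is a quotient map, so continuity may be tested after composing with `F`,
    -- where the inverse no longer appears.
    rw [hF.isQuotientMap.continuous_iff, this]
    refine ⟨fun h => ?_, fun h => continuous_const.mul h⟩
    have h' := (continuous_const (y := ((2 * (Real.pi : ℂ)) ^ n)⁻¹)).mul h
    simpa only [Pi.mul_def, inv_mul_cancel_left₀ hc] using h'
  · rw [← map_zero F, hval]
    simp [hc]
  · refine ⟨fun h ξ u hu t ht => ?_, fun h x v hv t ht => ?_⟩
    · obtain ⟨r, s, hr, hs, h⟩ := h (F ξ) (F u) (Set.mem_image_of_mem F hu) t ht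
      refine ⟨r, s, hr, hs, mul_left_cancel₀ hc ?_⟩
      rw [← map_smul, ← map_add, hval, hval, hval] at h
      rw [h]
      simp only [smul_eq_mul]
      ring
    · obtain ⟨u, hu, rfl⟩ := hv
      obtain ⟨ξ, rfl⟩ := hF.surjective x
      obtain ⟨r, s, hr, hs, h⟩ := h ξ u hu t ht
      refine ⟨r, s, hr, hs, ?_⟩
      rw [← map_smul, ← map_add, hval, hval, hval, h]
      simp only [smul_eq_mul]
      ring

/-- The Fourier transform of demi-distributions, for any linear homeomorphism in place of the
Fourier transform of test functions. -/
theorem fourierFunctional_of_isHomeomorph (n : ℕ) (γ : ℂ → ℂ) {F : E →ₗ[ℂ] G}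
    (hF : IsHomeomorph F) :
    Bijective F ∧
      ∀ U ∈ 𝓝 (0 : E),
        F '' U ∈ 𝓝 0 ∧
        (∀ (f : E → ℂ) (ξ : E),
          fourierFunctional n F f (F ξ) = (2 * (Real.pi : ℂ)) ^ n * f ξ) ∧
        Set.BijOn (fourierFunctional n F) (DemiDist γ U) (DemiDist γ (F '' U)) ∧
        (∀ (m : ℕ) (α : Fin m → ℂ) (f : Fin m → E → ℂ), (∀ k, f k ∈ DemiDist γ U) →
          fourierFunctional n F (∑ k, α k • f k) =
              ∑ k, α k • fourierFunctional n F (f k) ∧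
            fourierFunctional n F (∑ k, α k • f k) ∈ DemiDistSpan γ (F '' U)) ∧
        Set.BijOn (fourierFunctional n F) (DemiDistSpan γ U) (DemiDistSpan γ (F '' U)) ∧
        ∃ T : DemiDistSpan γ U →ₗ[ℂ] DemiDistSpan γ (F '' U),
          Continuous T ∧ ∀ f : DemiDistSpan γ U, (T f).1 = fourierFunctional n F f.1 := by
  refine ⟨hF.bijective, fun U hU => ?_⟩
  have hinj := fourierFunctional_injective n hF.injective
  have hbij : Set.BijOn (fourierFunctional n F) (DemiDist γ U) (DemiDist γ (F '' U)) := by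
    refine ⟨fun f hf => (fourierFunctional_mem_demiDist_iff n hF γ U f).2 hf, hinj.injOn,
      fun g hg => ?_⟩
    obtain ⟨f, rfl⟩ := fourierFunctional_surjective n hF.bijective g
    exact ⟨f, (fourierFunctional_mem_demiDist_iff n hF γ U f).1 hg, rfl⟩
  have hmap : (DemiDistSpan γ U).map (fourierFunctionalLM n F) = DemiDistSpan γ (F '' U) := by
    rw [DemiDistSpan, Submodule.map_span]
    exact congrArg _ hbij.image_eq
  have hspan : Set.BijOn (fourierFunctional n F) (DemiDistSpan γ U) (DemiDistSpan γ (F '' U)) := by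
    rw [← hmap]
    exact hinj.injOn.bijOn_image
  refine ⟨?_, fourierFunctional_apply n hF.injective, hbij, fun m α f hf => ?_, hspan, ?_⟩
  · simpa using hF.isOpenMap.image_mem_nhds hU
  · refine ⟨?_, hspan.mapsTo (Submodule.sum_mem _ fun k _ => Submodule.smul_mem _ _
      (Submodule.subset_span (hf k)))⟩
    change fourierFunctionalLM n F _ = ∑ k, α k • fourierFunctionalLM n F (f k)
    simp
  · refine ⟨(fourierFunctionalLM n F).restrict fun f hf => hspan.mapsTo hf, ?_, fun f => rfl⟩
    refine Continuous.subtype_mk (continuous_pi fun ζ => ?_) _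
    -- For pointwise convergence only evaluations matter, and each is a constant times evaluation at
    -- `invFun F ζ`.
    exact continuous_const.mul ((continuous_apply (invFun F ζ)).comp continuous_subtype_val)

end Transport

/-! ### The Schwartz space -/

/-- Both factors are invertible: the standard transform is a continuous linear equivalence, and the
dilation by `-(2π)⁻¹` is undone by the inverse dilation. -/
lemma fourierS_isHomeomorph (n : ℕ) : IsHomeomorph (fourierS n) := by
  have h : ⇑(fourierS n) =
      (SchwartzMap.compCLMOfContinuousLinearEquiv ℂ
        (ContinuousLinearEquiv.smulLeft (R₁ := ℝ) (M₁ := EuclideanSpace ℝ (Fin n))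
          (Units.mk0 (-(2 * Real.pi)⁻¹) (by simp [Real.pi_ne_zero])))) ∘
      (FourierTransform.fourierCLE ℂ (TestS n)) := by
    funext ξ
    ext σ
    exact (fourierSAux_apply n ξ σ).symm
  rw [h]
  refine IsHomeomorph.comp ?_ (FourierTransform.fourierCLE ℂ (TestS n)).toHomeomorph.isHomeomorph
  set e := ContinuousLinearEquiv.smulLeft (R₁ := ℝ) (M₁ := EuclideanSpace ℝ (Fin n))
    (Units.mk0 (-(2 * Real.pi)⁻¹) (by simp [Real.pi_ne_zero]))
  refine isHomeomorph_iff_exists_inverse.2 ⟨ContinuousLinearMap.continuous _,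
    SchwartzMap.compCLMOfContinuousLinearEquiv ℂ e.symm, fun f => ?_, fun f => ?_,
    ContinuousLinearMap.continuous _⟩ <;> ext <;> simp

/-! ### Decay of the functions in `Z(a)` and the inverse transform -/

lemma zSeminormAux_le_zNorm {n p : ℕ} {a : ℝ} {α : Fin n → ℕ} (hα : ∑ j, α j ≤ p)
    (ζ : ZSpace n a) : zSeminormAux n a α ζ ≤ zNorm n a p ζ := by
  have hmem : α ∈ multiIndices n p := by
    simp only [multiIndices, Finset.mem_filter, Fintype.mem_piFinset, Finset.mem_range]
    exact ⟨fun j => Nat.lt_succ_of_le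
      ((Finset.single_le_sum (fun _ _ => Nat.zero_le _) (Finset.mem_univ j)).trans hα), hα⟩
  exact Finset.le_sup (f := zSeminormAux n a) hmem ζ

lemma ZSpace.norm_monom_mul_le {n p : ℕ} {a : ℝ} {α : Fin n → ℕ} (hα : ∑ j, α j ≤ p)
    (ζ : ZSpace n a) (z : Fin n → ℂ) :
    ‖monom α z * ζ z‖ ≤ zNorm n a p ζ * Real.exp (a * imNorm z) := by
  have h := (le_ciSup (ζ.bddAbove α) z).trans (zSeminormAux_le_zNorm hα ζ)
  rwa [Real.exp_neg, mul_inv_le_iff₀ (Real.exp_pos _)] at h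

/-- A single well-chosen monomial dominates `(1 + ‖z‖) ^ p`: the constant one when `‖z‖ ≤ 1`,
otherwise the `p`-th power of a coordinate of maximal modulus, which equals the sup norm. In both
cases the factor 2 absorbs the summand 1. -/
lemma ZSpace.pow_mul_norm_le {n : ℕ} {a : ℝ} (p : ℕ) (ζ : ZSpace n a) (z : Fin n → ℂ) :
    (1 + ‖z‖) ^ p * ‖ζ z‖ ≤ 2 ^ p * zNorm n a p ζ * Real.exp (a * imNorm z) := by
  obtain ⟨α, hα, h⟩ : ∃ α : Fin n → ℕ, ∑ j, α j ≤ p ∧ (1 + ‖z‖) ^ p ≤ 2 ^ p * ‖monom α z‖ := by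
    rcases le_or_gt ‖z‖ 1 with hz | hz
    · refine ⟨0, by simp, ?_⟩
      simp only [monom, Pi.zero_apply, pow_zero, Finset.prod_const_one, norm_one, mul_one]
      exact pow_le_pow_left₀ (by positivity) (by linarith) p
    · have hn : Nonempty (Fin n) := by
        by_contra hn
        rw [not_nonempty_iff] at hn
        rw [Subsingleton.elim z 0, norm_zero] at hz
        linarith
      obtain ⟨j, hj⟩ := Finite.exists_max fun j => ‖z j‖
      have hzj : ‖z‖ ≤ ‖z j‖ := (pi_norm_le_iff_of_nonneg (norm_nonneg _)).2 hj
      refine ⟨Pi.single j p, by simp, ?_⟩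
      have hm : monom (Pi.single j p) z = z j ^ p := by
        rw [monom, Finset.prod_eq_single j (fun k _ hk => by simp [hk]) (by simp)]
        simp
      rw [hm, norm_pow, ← mul_pow]
      exact pow_le_pow_left₀ (by positivity) (by linarith) p
  calc (1 + ‖z‖) ^ p * ‖ζ z‖ ≤ 2 ^ p * ‖monom α z‖ * ‖ζ z‖ := by gcongr
    _ = 2 ^ p * ‖monom α z * ζ z‖ := by rw [norm_mul, mul_assoc]
    _ ≤ 2 ^ p * (zNorm n a p ζ * Real.exp (a * imNorm z)) := by
        gcongr; exact ζ.norm_monom_mul_le hα z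
    _ = _ := by ring

/-- The point `2πv` of `ℝⁿ`, as an element of `ℂⁿ`. -/
noncomputable def twoPiPoint {n : ℕ} (v : EuclideanSpace ℝ (Fin n)) : Fin n → ℂ :=
  fun j => ((2 * Real.pi * v j : ℝ) : ℂ)

@[fun_prop]
lemma continuous_twoPiPoint {n : ℕ} :
    Continuous (twoPiPoint : EuclideanSpace ℝ (Fin n) → Fin n → ℂ) := by
  unfold twoPiPoint; fun_prop

lemma imNorm_twoPiPoint {n : ℕ} (v : EuclideanSpace ℝ (Fin n)) : imNorm (twoPiPoint v) = 0 := by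
  simp only [imNorm, twoPiPoint, Complex.ofReal_im, abs_zero, Finset.sum_const_zero]

lemma EuclideanSpace.norm_le_sum_norm {n : ℕ} (v : EuclideanSpace ℝ (Fin n)) :
    ‖v‖ ≤ ∑ j, ‖v j‖ := by
  have hv := (EuclideanSpace.basisFun (Fin n) ℝ).sum_repr v
  calc ‖v‖ = ‖∑ j, v j • EuclideanSpace.basisFun (Fin n) ℝ j‖ := by
        conv_lhs => rw [← hv]
        simp
    _ ≤ ∑ j, ‖v j • EuclideanSpace.basisFun (Fin n) ℝ j‖ := norm_sum_le _ _
    _ = ∑ j, ‖v j‖ := by simp [norm_smul]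

lemma norm_le_mul_norm_twoPiPoint {n : ℕ} (v : EuclideanSpace ℝ (Fin n)) :
    ‖v‖ ≤ n * ‖twoPiPoint v‖ := by
  have hj (j : Fin n) : ‖v j‖ ≤ ‖twoPiPoint v‖ := by
    refine le_trans ?_ (norm_le_pi_norm (twoPiPoint v) j)
    rw [twoPiPoint, Complex.norm_real, norm_mul]
    refine le_mul_of_one_le_left (norm_nonneg _) ?_
    rw [Real.norm_eq_abs, abs_of_pos Real.two_pi_pos]
    linarith [Real.pi_gt_three]
  refine (EuclideanSpace.norm_le_sum_norm v).trans ((Finset.sum_le_sum fun j _ => hj j).trans ?_)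
  simp

lemma ZSpace.pow_mul_norm_twoPiPoint_le {n : ℕ} {a : ℝ} (p : ℕ) (ζ : ZSpace n a)
    (v : EuclideanSpace ℝ (Fin n)) :
    (1 + ‖v‖) ^ p * ‖ζ (twoPiPoint v)‖ ≤ (2 * (1 + n)) ^ p * zNorm n a p ζ := by
  have h := ζ.pow_mul_norm_le p (twoPiPoint v)
  rw [imNorm_twoPiPoint, mul_zero, Real.exp_zero, mul_one] at h
  have hv : 1 + ‖v‖ ≤ (1 + n) * (1 + ‖twoPiPoint v‖) := by
    have := norm_le_mul_norm_twoPiPoint v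
    have := norm_nonneg (twoPiPoint v)
    have : (0 : ℝ) ≤ n := n.cast_nonneg
    nlinarith
  calc (1 + ‖v‖) ^ p * ‖ζ (twoPiPoint v)‖
      ≤ ((1 + n) * (1 + ‖twoPiPoint v‖)) ^ p * ‖ζ (twoPiPoint v)‖ := by gcongr
    _ = (1 + n) ^ p * ((1 + ‖twoPiPoint v‖) ^ p * ‖ζ (twoPiPoint v)‖) := by rw [mul_pow, mul_assoc]
    _ ≤ (1 + n) ^ p * (2 ^ p * zNorm n a p ζ) := by gcongr
    _ = _ := by rw [mul_pow]; ring

lemma ZSpace.continuous {n : ℕ} {a : ℝ} (ζ : ZSpace n a) : Continuous ζ := ζ.2.1.continuous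

/-- Spending `n + 1` extra powers, one more than the dimension, leaves an integrable weight on `ℝⁿ`.
-/
lemma ZSpace.pow_mul_norm_twoPiPoint_le_rpow {n : ℕ} {a : ℝ} (k : ℕ) (ζ : ZSpace n a)
    (v : EuclideanSpace ℝ (Fin n)) :
    ‖v‖ ^ k * ‖ζ (twoPiPoint v)‖ ≤
      (2 * (1 + n)) ^ (k + (n + 1)) * zNorm n a (k + (n + 1)) ζ * (1 + ‖v‖) ^ (-(n + 1 : ℝ)) := by
  have h := ζ.pow_mul_norm_twoPiPoint_le (k + (n + 1)) v
  have hpos : 0 < (1 + ‖v‖) ^ (n + 1) := by positivity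
  have hr : (1 + ‖v‖) ^ (-(n + 1 : ℝ)) = ((1 + ‖v‖) ^ (n + 1))⁻¹ := by
    rw [Real.rpow_neg (by positivity)]
    exact_mod_cast congrArg _ (Real.rpow_natCast (1 + ‖v‖) (n + 1))
  rw [hr, ← div_eq_mul_inv, le_div_iff₀ hpos]
  refine le_trans ?_ h
  have hk : ‖v‖ ^ k ≤ (1 + ‖v‖) ^ k := pow_le_pow_left₀ (norm_nonneg _) (by linarith) k
  rw [pow_add _ k (n + 1), mul_right_comm]
  gcongr

lemma integrable_one_add_norm_euclidean (n : ℕ) :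
    Integrable fun v : EuclideanSpace ℝ (Fin n) => (1 + ‖v‖) ^ (-(n + 1 : ℝ)) :=
  integrable_one_add_norm (by simp)

lemma ZSpace.integrable_pow_mul {n : ℕ} {a : ℝ} (k : ℕ) (ζ : ZSpace n a) :
    Integrable fun v : EuclideanSpace ℝ (Fin n) => ‖v‖ ^ k * ‖ζ (twoPiPoint v)‖ := by
  refine ((integrable_one_add_norm_euclidean n).const_mul
    ((2 * (1 + n)) ^ (k + (n + 1)) * zNorm n a (k + (n + 1)) ζ)).mono' ?_
    (Eventually.of_forall fun v => ?_)
  · have := ζ.continuous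
    exact Continuous.aestronglyMeasurable (by fun_prop)
  · rw [Real.norm_of_nonneg (by positivity)]
    exact ζ.pow_mul_norm_twoPiPoint_le_rpow k v

lemma ZSpace.integrable {n : ℕ} {a : ℝ} (ζ : ZSpace n a) :
    Integrable fun v : EuclideanSpace ℝ (Fin n) => ζ (twoPiPoint v) := by
  have h := ζ.integrable_pow_mul 0
  simp only [pow_zero, one_mul] at h
  have hc := ζ.continuous
  exact (integrable_norm_iff (Continuous.aestronglyMeasurable (by fun_prop))).1 h

/-- The inverse Fourier transform of `ζ ∈ Z(a)`. After the substitution `σ = 2πv` it is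
`x ↦ (2π)⁻ⁿ ∫ ζ(σ) e^{-i(x,σ)} dσ`. -/
noncomputable def ZSpace.inv {n : ℕ} {a : ℝ} (ζ : ZSpace n a) : EuclideanSpace ℝ (Fin n) → ℂ :=
  𝓕 fun v : EuclideanSpace ℝ (Fin n) => ζ (twoPiPoint v)

lemma ZSpace.contDiff_inv {n : ℕ} {a : ℝ} (ζ : ZSpace n a) : ContDiff ℝ ∞ ζ.inv :=
  Real.contDiff_fourier (N := ⊤) fun k _ => ζ.integrable_pow_mul k

/-- Differentiating under the Fourier integral brings down powers `‖v‖ ^ p` with `p ≤ k`, and the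
norm of order `p + n + 1` controls the integral of each. This is the continuity estimate for `F⁻¹`.
-/
lemma ZSpace.exists_norm_iteratedFDeriv_inv_le (n : ℕ) (a : ℝ) (k : ℕ) :
    ∃ C : NNReal, ∃ s : Finset ℕ, ∀ (ζ : ZSpace n a) (x : EuclideanSpace ℝ (Fin n)),
      ‖iteratedFDeriv ℝ k ζ.inv x‖ ≤ (C • s.sup (zNorm n a)) ζ := by
  set I : ℝ := ∫ v : EuclideanSpace ℝ (Fin n), (1 + ‖v‖) ^ (-(n + 1 : ℝ)) with hI
  have hI0 : 0 ≤ I := integral_nonneg fun v => by positivity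
  set c : ℕ → ℝ := fun p => (2 * (1 + n)) ^ (p + (n + 1)) * I with hc
  set s : Finset ℕ := (Finset.range (k + 1)).image fun p => p + (n + 1) with hs
  refine ⟨⟨(2 * Real.pi) ^ k * ∑ p ∈ Finset.range (k + 1), c p,
    mul_nonneg (by positivity) (Finset.sum_nonneg fun p _ => by positivity)⟩, s, fun ζ x => ?_⟩
  have hc' : Continuous fun v : EuclideanSpace ℝ (Fin n) => ζ (twoPiPoint v) :=
    ζ.continuous.comp continuous_twoPiPoint
  -- Here `n := 0` is the exponent of the polynomial weight in `x`, not the dimension; without a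
  -- weight no derivative of `ζ` is needed, hence `N := 0`.
  have h := Real.pow_mul_norm_iteratedFDeriv_fourier_le (K := ⊤) (N := 0) (k := k) (n := 0)
    (f := fun v : EuclideanSpace ℝ (Fin n) => ζ (twoPiPoint v))
    (contDiff_zero.2 hc')
    (fun k m _ hm => by
      obtain rfl : m = 0 := by simpa using hm
      simpa using ζ.integrable_pow_mul k) le_top le_rfl x
  simp only [pow_zero, one_mul, mul_one, zero_add, Finset.range_one, Finset.product_singleton,
    Finset.sum_map, Function.Embedding.coeFn_mk, norm_iteratedFDeriv_zero] at h
  refine h.trans ?_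
  change _ ≤ ((2 * Real.pi) ^ k * ∑ p ∈ Finset.range (k + 1), c p) * (s.sup (zNorm n a)) ζ
  rw [mul_assoc, Finset.sum_mul]
  gcongr with p hp
  have hle : zNorm n a (p + (n + 1)) ζ ≤ (s.sup (zNorm n a)) ζ :=
    Finset.le_sup (f := zNorm n a) (Finset.mem_image_of_mem (fun p => p + (n + 1)) hp) ζ
  calc ∫ v : EuclideanSpace ℝ (Fin n), ‖v‖ ^ p * ‖ζ (twoPiPoint v)‖
      ≤ ∫ v : EuclideanSpace ℝ (Fin n), (2 * (1 + n)) ^ (p + (n + 1)) *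
          zNorm n a (p + (n + 1)) ζ * (1 + ‖v‖) ^ (-(n + 1 : ℝ)) :=
        integral_mono (ζ.integrable_pow_mul p)
          ((integrable_one_add_norm_euclidean n).const_mul _)
          (ζ.pow_mul_norm_twoPiPoint_le_rpow p)
    _ = c p * zNorm n a (p + (n + 1)) ζ := by rw [integral_const_mul, hc]; ring
    _ ≤ c p * (s.sup (zNorm n a)) ζ := by gcongr

/-! ### Fourier inversion on real points, and uniqueness of entire extensions -/

lemma fourierInt_twoPiPoint {n : ℕ} (ξ : EuclideanSpace ℝ (Fin n) → ℂ)
    (v : EuclideanSpace ℝ (Fin n)) : fourierInt ξ (twoPiPoint v) = 𝓕⁻ ξ v := by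
  rw [Real.fourierInv_eq', fourierInt]
  congr 1
  funext x
  rw [smul_eq_mul, mul_comm]
  congr 2
  rw [PiLp.inner_apply, mul_comm]
  congr 1
  push_cast [twoPiPoint]
  rw [Finset.mul_sum]
  refine Finset.sum_congr rfl fun j _ => ?_
  simp
  ring

lemma SmoothIn.inv_fourierInt {n : ℕ} {a : ℝ} {f : EuclideanSpace ℝ (Fin n) → ℂ}
    (hf : SmoothIn n a f) : ZSpace.inv (a := a) ⟨fourierInt f, hf.fourierInt_mem⟩ = f := by
  have hint := ZSpace.integrable (a := a) ⟨fourierInt f, hf.fourierInt_mem⟩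
  have heq : (fun v => fourierInt f (twoPiPoint v)) = 𝓕⁻ f := funext (fourierInt_twoPiPoint f)
  change Integrable fun v => fourierInt f (twoPiPoint v) at hint
  change 𝓕 (fun v => fourierInt f (twoPiPoint v)) = f
  rw [heq] at hint ⊢
  have hfi : Integrable f := by simpa using hf.integrable (fun _ => 1) continuous_const
  refine hf.1.continuous.fourier_fourierInv_eq hfi ?_
  -- The inversion theorem asks for integrability of `𝓕 f`, which is the reflection of `𝓕⁻ f`.
  refine hint.comp_neg.congr (Eventually.of_forall fun v => ?_)
  simp [Real.fourierInv_eq_fourier_neg]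

lemma ZSpace.fourierInt_inv_twoPiPoint {n : ℕ} {a : ℝ} (ζ : ZSpace n a) (h : Integrable ζ.inv)
    (v : EuclideanSpace ℝ (Fin n)) : fourierInt ζ.inv (twoPiPoint v) = ζ (twoPiPoint v) := by
  rw [fourierInt_twoPiPoint]
  exact congrFun ((ζ.continuous.comp continuous_twoPiPoint).fourierInv_fourier_eq ζ.integrable h) v

/-- An entire function on `ℂⁿ` vanishing on `ℝⁿ` is zero. -/
lemma Differentiable.eq_zero_of_real {n : ℕ} {h : (Fin n → ℂ) → ℂ} (hd : Differentiable ℂ h)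
    (h0 : ∀ x : Fin n → ℝ, h (fun j => (x j : ℂ)) = 0) : h = 0 := by
  -- The set `s` holds the coordinates allowed to be complex. Freeing one more coordinate is the
  -- one-variable identity theorem: the function already vanishes on the real line, which
  -- accumulates at 0.
  have key : ∀ (s : Finset (Fin n)) (z : Fin n → ℂ), (∀ j ∉ s, (z j).im = 0) → h z = 0 := by
    intro s
    induction s using Finset.induction_on with
    | empty =>
      intro z hz
      convert h0 fun j => (z j).re using 2
      funext j
      exact Complex.ext (by simp) (by simp [hz j])
    | insert j s _ ih =>
      intro z hz
      have hdiff : Differentiable ℂ fun w : ℂ => h (Function.update z j w) :=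
        hd.comp fun w => (hasFDerivAt_update z w).differentiableAt
      have heq : (fun w : ℂ => h (Function.update z j w)) = 0 := by
        refine AnalyticOnNhd.eq_of_frequently_eq (z₀ := 0)
          (fun w _ => hdiff.analyticAt w) (fun w _ => analyticAt_const) ?_
        have hreal (t : ℝ) : h (Function.update z j (t : ℂ)) = 0 := by
          refine ih _ fun k hk => ?_
          by_cases hkj : k = j
          · subst hkj; simp
          · rw [Function.update_of_ne hkj]
            exact hz k (by simp [hkj, hk])
        have ht : Tendsto (fun t : ℝ => (t : ℂ)) (𝓝[≠] 0) (𝓝[≠] 0) := by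
          refine tendsto_nhdsWithin_of_tendsto_nhds_of_eventually_within _ ?_ ?_
          · exact (Complex.continuous_ofReal.tendsto' 0 0 (by simp)).mono_left nhdsWithin_le_nhds
          · filter_upwards [self_mem_nhdsWithin] with t ht
            simpa using ht
        exact ht.frequently (Frequently.of_forall fun t => by simpa using hreal t)
      simpa using congrFun heq (z j)
  exact funext fun z => key Finset.univ z (by simp)

/-! ### Continuity of the Fourier transform of test functions -/

/-- The witness is `i ∂ₖ f`, by integration by parts. Compared with `SmoothIn.coord_mul`, it also
records that this costs exactly one derivative, as continuity of `F` requires. -/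
lemma SmoothIn.coord_mul_of_norm_le {n : ℕ} {a : ℝ} {f : EuclideanSpace ℝ (Fin n) → ℂ}
    (hf : SmoothIn n a f) (k : Fin n) :
    ∃ g, SmoothIn n a g ∧ (∀ z, z k * fourierInt f z = fourierInt g z) ∧
      ∀ m x, ‖iteratedFDeriv ℝ m g x‖ ≤ ‖iteratedFDeriv ℝ (m + 1) f x‖ := by
  set v : EuclideanSpace ℝ (Fin n) := EuclideanSpace.single k 1 with hv
  have hsm : ContDiff ℝ ∞ fun x => fderiv ℝ f x v :=
    (hf.1.fderiv_right (m := ∞) (by simp)).clm_apply contDiff_const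
  have hD : SmoothIn n a fun x => fderiv ℝ f x v := by
    refine ⟨hsm, fun x hx => ?_⟩
    have : f =ᶠ[𝓝 x] fun _ => 0 := by
      filter_upwards [(isOpen_lt continuous_const continuous_norm).mem_nhds hx] with y hy
      exact hf.2 y hy
    simp [this.fderiv_eq]
  refine ⟨fun x => Complex.I * fderiv ℝ f x v,
    ⟨contDiff_const.mul hsm, fun x hx => by simp [hD.2 x hx]⟩, fun z => ?_, fun m x => ?_⟩
  swap
  -- The witness is `L` applied to `fderiv ℝ f`, and `‖L‖ ≤ 1` because the basis vector `v` has norm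
  -- 1.
  · set L : (EuclideanSpace ℝ (Fin n) →L[ℝ] ℂ) →L[ℝ] ℂ :=
      Complex.I • ContinuousLinearMap.apply ℝ ℂ v with hL
    have hLn : ‖L‖ ≤ 1 := by
      refine ContinuousLinearMap.opNorm_le_bound _ zero_le_one fun T => ?_
      have h1 : ‖v‖ = 1 := by simp [hv]
      simpa [hL, h1] using T.le_opNorm v
    have hfd : ContDiff ℝ ∞ (fderiv ℝ f) := hf.1.fderiv_right (by simp)
    have h := L.norm_iteratedFDeriv_comp_left (n := m) (N := ∞) (hfd.contDiffAt (x := x))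
      (by exact_mod_cast le_top)
    refine h.trans ?_
    rw [norm_iteratedFDeriv_fderiv]
    exact mul_le_of_le_one_left (norm_nonneg _) hLn
  set e : EuclideanSpace ℝ (Fin n) → ℂ :=
    fun x => Complex.exp (Complex.I * ∑ j, (x j : ℂ) * z j) with he
  have hlin : ∀ x, HasFDerivAt
      (fun x : EuclideanSpace ℝ (Fin n) => Complex.I * ∑ j, (x j : ℂ) * z j)
      (Complex.I • ∑ j, (z j) • (Complex.ofRealCLM.comp
        (EuclideanSpace.proj (𝕜 := ℝ) j))) x := by
    intro x
    have h : (fun x : EuclideanSpace ℝ (Fin n) => Complex.I * ∑ j, (x j : ℂ) * z j)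
        = ⇑(Complex.I • ∑ j, (z j) • (Complex.ofRealCLM.comp
        (EuclideanSpace.proj (𝕜 := ℝ) j) : EuclideanSpace ℝ (Fin n) →L[ℝ] ℂ)) := by
      funext y; simp [mul_comm]
    rw [h]
    exact ContinuousLinearMap.hasFDerivAt _
  have hde : ∀ x, HasFDerivAt e (e x • (Complex.I • ∑ j, (z j) • (Complex.ofRealCLM.comp
        (EuclideanSpace.proj (𝕜 := ℝ) j)))) x := fun x => (hlin x).cexp
  have hdev : ∀ x, fderiv ℝ e x v = Complex.I * z k * e x := by
    intro x
    rw [(hde x).fderiv]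
    have : ∑ j, z j * ((if j = k then (1 : ℝ) else 0 : ℝ) : ℂ) = z k := by
      rw [Finset.sum_eq_single k] <;> simp +contextual
    simp [hv, this]
    ring
  have hce : Continuous e := continuous_kernel z
  have hparts := integral_mul_fderiv_eq_neg_fderiv_mul_of_integrable
    (μ := (volume : Measure (EuclideanSpace ℝ (Fin n)))) (𝕜 := ℂ) (f := f) (g := e) (v := v)
    (hD.integrable e hce)
    (by simp only [hdev]; exact hf.integrable _ (continuous_const.mul hce))
    (hf.integrable e hce)
    (fun x _ => hf.1.differentiable (by simp) x)
    (fun x _ => (hde x).differentiableAt)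
  simp only [hdev] at hparts
  have h1 : ∫ x, f x * (Complex.I * z k * e x) = Complex.I * z k * fourierInt f z := by
    rw [fourierInt, ← integral_const_mul]
    congr 1; funext x; ring
  have h2 : fourierInt (fun x => Complex.I * fderiv ℝ f x v) z
      = Complex.I * ∫ x, fderiv ℝ f x v * e x := by
    rw [fourierInt, ← integral_const_mul]
    congr 1; funext x; rw [mul_assoc]
  rw [h1] at hparts
  rw [h2, ← neg_eq_iff_eq_neg.2 hparts]
  linear_combination (z k * fourierInt f z) * Complex.I_mul_I

lemma SmoothIn.monom_mul_of_norm_le {n : ℕ} {a : ℝ} {f : EuclideanSpace ℝ (Fin n) → ℂ}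
    (hf : SmoothIn n a f) (α : Fin n → ℕ) :
    ∃ g, SmoothIn n a g ∧ (∀ z, monom α z * fourierInt f z = fourierInt g z) ∧
      ∀ m x, ‖iteratedFDeriv ℝ m g x‖ ≤ ‖iteratedFDeriv ℝ (m + ∑ j, α j) f x‖ := by
  have hpow : ∀ (k : Fin n) (p : ℕ) (f : EuclideanSpace ℝ (Fin n) → ℂ), SmoothIn n a f →
      ∃ g, SmoothIn n a g ∧ (∀ z, z k ^ p * fourierInt f z = fourierInt g z) ∧
        ∀ m x, ‖iteratedFDeriv ℝ m g x‖ ≤ ‖iteratedFDeriv ℝ (m + p) f x‖ := by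
    intro k p
    induction p with
    | zero => exact fun f hf => ⟨f, hf, fun z => by simp, fun m x => le_rfl⟩
    | succ p ih =>
      intro f hf
      obtain ⟨g, hg, hg', hgn⟩ := hf.coord_mul_of_norm_le k
      obtain ⟨h, hh, hh', hhn⟩ := ih g hg
      exact ⟨h, hh, fun z => by rw [pow_succ, mul_assoc, hg', hh'],
        fun m x => (hhn m x).trans (hgn (m + p) x)⟩
  have hprod : ∀ s : Finset (Fin n), ∃ g, SmoothIn n a g ∧
      (∀ z, (∏ k ∈ s, z k ^ α k) * fourierInt f z = fourierInt g z) ∧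
        ∀ m x, ‖iteratedFDeriv ℝ m g x‖ ≤ ‖iteratedFDeriv ℝ (m + ∑ j ∈ s, α j) f x‖ := by
    intro s
    induction s using Finset.induction_on with
    | empty => exact ⟨f, hf, fun z => by simp, fun m x => le_rfl⟩
    | insert k s hk ih =>
      obtain ⟨g, hg, hg', hgn⟩ := ih
      obtain ⟨h, hh, hh', hhn⟩ := hpow k (α k) g hg
      refine ⟨h, hh, fun z => by rw [Finset.prod_insert hk, mul_assoc, hg', hh'],
        fun m x => (hhn m x).trans ?_⟩
      rw [Finset.sum_insert hk, ← add_assoc]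
      exact hgn (m + α k) x
  exact hprod Finset.univ

/-- The monomial becomes a derivative of order `|α|`, whose `L¹` norm is at most its supremum times
the volume of the ball containing its support. -/
lemma SmoothIn.norm_monom_mul_fourierInt_le {n : ℕ} {a : ℝ}
    {f : EuclideanSpace ℝ (Fin n) → ℂ} (hf : SmoothIn n a f) (α : Fin n → ℕ) {M : ℝ}
    (hM : ∀ x, ‖iteratedFDeriv ℝ (∑ j, α j) f x‖ ≤ M) (z : Fin n → ℂ) :
    ‖monom α z * fourierInt f z‖ ≤
      volume.real (Metric.closedBall (0 : EuclideanSpace ℝ (Fin n)) a) * M *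
        Real.exp (a * imNorm z) := by
  obtain ⟨g, hg, hg', hgn⟩ := hf.monom_mul_of_norm_le α
  have hgM (x) : ‖g x‖ ≤ M := by
    have := hgn 0 x
    rw [norm_iteratedFDeriv_zero, zero_add] at this
    exact this.trans (hM x)
  rw [hg']
  refine (hg.norm_fourierInt_le z).trans ?_
  gcongr
  rw [← setIntegral_eq_integral_of_forall_compl_eq_zero
    (s := Metric.closedBall (0 : EuclideanSpace ℝ (Fin n)) a)
    (fun x hx => by rw [hg.2 x (by simpa using hx), norm_zero])]
  rw [mul_comm]
  refine (le_abs_self _).trans ?_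
  rw [← Real.norm_eq_abs]
  exact norm_setIntegral_le_of_norm_le_const measure_closedBall_lt_top
    (fun x _ => by simpa using hgM x)

/-! ### Continuity between `𝓓_K` and `Z(a)` in both directions -/

lemma ContDiffMapSupportedIn.smoothIn {n : ℕ} {a : ℝ}
    {K : TopologicalSpace.Compacts (EuclideanSpace ℝ (Fin n))}
    (hK : (K : Set (EuclideanSpace ℝ (Fin n))) ⊆ Metric.closedBall 0 a)
    (ξ : ContDiffMapSupportedIn (EuclideanSpace ℝ (Fin n)) ℂ ⊤ K) : SmoothIn n a ξ :=
  ⟨ξ.contDiff, fun x hx => ξ.zero_on_compl fun h => by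
    have := hK h
    rw [mem_closedBall_zero_iff] at this
    exact not_lt.2 this hx⟩

/-- The Fourier transform `𝓓_K → Z(a)`, where `K` is contained in the ball of radius `a`. -/
noncomputable def fourierSupportedIn {n : ℕ} {a : ℝ}
    {K : TopologicalSpace.Compacts (EuclideanSpace ℝ (Fin n))}
    (hK : (K : Set (EuclideanSpace ℝ (Fin n))) ⊆ Metric.closedBall 0 a) :
    ContDiffMapSupportedIn (EuclideanSpace ℝ (Fin n)) ℂ ⊤ K →ₗ[ℂ] ZSpace n a where
  toFun ξ := ⟨fourierInt ξ, (ξ.smoothIn hK).fourierInt_mem⟩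
  map_add' ξ η := Subtype.ext ((ξ.smoothIn hK).fourierInt_add (η.smoothIn hK))
  map_smul' c ξ := Subtype.ext (fourierInt_smul c ξ)

lemma continuous_fourierSupportedIn {n : ℕ} {a : ℝ}
    {K : TopologicalSpace.Compacts (EuclideanSpace ℝ (Fin n))}
    (hK : (K : Set (EuclideanSpace ℝ (Fin n))) ⊆ Metric.closedBall 0 a) :
    Continuous (fourierSupportedIn hK) := by
  refine WithSeminorms.continuous_of_isBounded (ContDiffMapSupportedIn.withSeminorms ℂ _ _ _ _)
    (zNorm_withSeminorms n a) _ fun p => ?_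
  set V : NNReal := ⟨volume.real (Metric.closedBall (0 : EuclideanSpace ℝ (Fin n)) a),
    measureReal_nonneg⟩ with hV
  set q := (Finset.range (p + 1)).sup
    (ContDiffMapSupportedIn.seminorm ℂ (EuclideanSpace ℝ (Fin n)) ℂ ⊤ K) with hq
  refine ⟨Finset.range (p + 1), V, fun ξ => ?_⟩
  change zNorm n a p (fourierSupportedIn hK ξ) ≤ V * q ξ
  refine Seminorm.finset_sup_apply_le (by positivity) fun α hα => ?_
  have hα' : ∑ j, α j ≤ p := (Finset.mem_filter.1 hα).2
  refine ciSup_le fun z => ?_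
  rw [Real.exp_neg, mul_inv_le_iff₀ (Real.exp_pos _)]
  refine (ξ.smoothIn hK).norm_monom_mul_fourierInt_le α (fun x => ?_) z
  refine (ContDiffMapSupportedIn.norm_iteratedFDeriv_apply_le_seminorm_top ℂ).trans ?_
  exact Finset.le_sup (f := ContDiffMapSupportedIn.seminorm ℂ (EuclideanSpace ℝ (Fin n)) ℂ ⊤ K)
    (Finset.mem_range.2 (Nat.lt_succ_of_le hα')) ξ

/-- The inverse Fourier transform with values in `𝓓_K` is continuous on any space with the topology
induced from `Z(a)`. -/
lemma continuous_of_coe_eq_inv {n : ℕ} {a : ℝ}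
    {K : TopologicalSpace.Compacts (EuclideanSpace ℝ (Fin n))}
    {X : Type*} [AddCommGroup X] [Module ℂ X]
    [TopologicalSpace X] {ι : X →ₗ[ℂ] ZSpace n a} (hι : IsInducing ι)
    (T : X →ₗ[ℂ] ContDiffMapSupportedIn (EuclideanSpace ℝ (Fin n)) ℂ ⊤ K)
    (hT : ∀ ζ, (T ζ : EuclideanSpace ℝ (Fin n) → ℂ) = (ι ζ).inv) : Continuous T := by
  -- The norms of `Z(a)` pulled back along `ι` generate the topology of `X`, so the estimate on
  -- `Z(a)` is all that is needed.
  have hp : WithSeminorms (SeminormFamily.comp (zNorm n a) ι) := by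
    have := LinearMap.withSeminorms_induced (zNorm_withSeminorms n a) ι
    rwa [← hι.eq_induced] at this
  refine WithSeminorms.continuous_of_isBounded hp
    (ContDiffMapSupportedIn.withSeminorms ℂ _ _ _ _) T fun k => ?_
  obtain ⟨C, s, h⟩ := ZSpace.exists_norm_iteratedFDeriv_inv_le n a k
  refine ⟨s, C, fun ζ => ?_⟩
  have hs : s.sup (SeminormFamily.comp (zNorm n a) ι) ζ = s.sup (zNorm n a) (ι ζ) := by
    simp only [Seminorm.finset_sup_apply, SeminormFamily.comp_apply, Seminorm.comp_apply]
  change ContDiffMapSupportedIn.seminorm ℂ _ _ ⊤ K k (T ζ) ≤ C * _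
  rw [hs]
  refine (ContDiffMapSupportedIn.seminorm_top_le_iff ℂ (by positivity) k _).2 fun x _ => ?_
  rw [hT]
  exact h (ι ζ) x

/-! ### The support of the inverse transform -/

/-- If `g` is entire and `O(|w|⁻²)` in the upper half plane, its integral along `ℝ` vanishes. -/
lemma integral_eq_zero_of_decay_upper {g : ℂ → ℂ} (hg : Differentiable ℂ g) {C : ℝ}
    (hC : ∀ w : ℂ, 0 ≤ w.im → (1 + ‖w‖) ^ 2 * ‖g w‖ ≤ C) : ∫ s : ℝ, g s = 0 := by
  -- A non-integrable function has integral 0 by convention, so integrability may be assumed.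
  by_cases hint : Integrable fun s : ℝ => g s
  swap
  · exact integral_undef hint
  have hC0 : 0 ≤ C := le_trans (by positivity) (hC 0 le_rfl)
  have hbound (R : ℝ) (w : ℂ) (hw : 0 ≤ w.im) (hR0 : 0 ≤ R) (hR : R ≤ ‖w‖) :
      ‖g w‖ ≤ C / (1 + R) ^ 2 := by
    rw [le_div_iff₀ (by positivity), mul_comm]
    refine le_trans ?_ (hC w hw)
    gcongr
  have h1 := intervalIntegral_tendsto_integral hint tendsto_neg_atTop_atBot tendsto_id
  refine tendsto_nhds_unique h1 ?_
  have h2 : Tendsto (fun R : ℝ => 4 * C / (1 + R)) atTop (𝓝 0) :=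
    tendsto_const_nhds.div_atTop (tendsto_atTop_add_const_left _ _ tendsto_id)
  refine squeeze_zero_norm' ?_ h2
  filter_upwards [eventually_ge_atTop 0] with R hR
  -- Cauchy's theorem on `[-R, R] × [0, R]`. The other three sides stay at distance at least `R`
  -- from 0 and have total length `4R`, so they contribute at most `4R · C / (1 + R)²`.
  have hrect := Complex.integral_boundary_rect_eq_zero_of_differentiableOn g (-R : ℝ)
    ((R : ℝ) + (R : ℝ) * Complex.I) hg.differentiableOn
  simp only [Complex.ofReal_re, Complex.ofReal_im, Complex.add_re, Complex.add_im, Complex.mul_re,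
    Complex.mul_im, Complex.I_re, Complex.I_im, mul_zero, mul_one, sub_self, add_zero, zero_add,
    Complex.ofReal_zero, zero_mul] at hrect
  set D := C / (1 + R) ^ 2 with hD
  have htop : ‖∫ x : ℝ in -R..R, g (x + R * Complex.I)‖ ≤ D * |R - -R| := by
    refine intervalIntegral.norm_integral_le_of_norm_le_const fun x _ => hbound R _ ?_ hR ?_
    · simpa using hR
    · refine le_trans ?_ (Complex.abs_im_le_norm _)
      simpa using le_abs_self R
  have hside (c : ℝ) (hc : R ≤ |c|) :
      ‖∫ y : ℝ in (0 : ℝ)..R, g (c + y * Complex.I)‖ ≤ D * |R - 0| := by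
    refine intervalIntegral.norm_integral_le_of_norm_le_const fun y hy => hbound R _ ?_ hR ?_
    · rw [Set.uIoc_of_le hR] at hy
      simpa using hy.1.le
    · refine hc.trans (le_trans ?_ (Complex.abs_re_le_norm _))
      simp
  have hright := hside R (le_abs_self R)
  have hleft := hside (-R) (by rw [abs_neg]; exact le_abs_self R)
  rw [sub_neg_eq_add, abs_of_nonneg (by linarith)] at htop
  rw [sub_zero, abs_of_nonneg hR] at hright hleft
  have heq : ∫ x : ℝ in -R..R, g x = (∫ x : ℝ in -R..R, g (x + R * Complex.I))
      - Complex.I • (∫ y : ℝ in (0 : ℝ)..R, g (R + y * Complex.I))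
      + Complex.I • ∫ y : ℝ in (0 : ℝ)..R, g ((-R : ℝ) + y * Complex.I) := by
    linear_combination hrect
  calc ‖∫ x : ℝ in -R..id R, g x‖ ≤ D * (R + R) + D * R + D * R := by
        rw [id, heq]
        refine (norm_add_le _ _).trans (add_le_add ((norm_sub_le _ _).trans
          (add_le_add htop ?_)) ?_)
        · rwa [norm_smul, Complex.norm_I, one_mul]
        · rwa [norm_smul, Complex.norm_I, one_mul]
    _ ≤ 4 * C / (1 + R) := by
        rw [le_div_iff₀ (by positivity), hD]
        have : C / (1 + R) ^ 2 * (1 + R) ^ 2 = C := by field_simp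
        have hD0 : 0 ≤ C / (1 + R) ^ 2 := by positivity
        nlinarith

/-- Integration over `ℝⁿ` by first integrating over one coordinate, when that integral vanishes. -/
lemma integral_eq_zero_of_integral_update_eq_zero {n : ℕ} {H : EuclideanSpace ℝ (Fin n) → ℂ}
    (j : Fin n) (h : ∀ v : Fin n → ℝ, ∫ s : ℝ, H (WithLp.toLp 2 (Function.update v j s)) = 0) :
    ∫ v, H v = 0 := by
  by_cases hH : Integrable H
  swap
  · exact integral_undef hH
  obtain ⟨m, rfl⟩ : ∃ m, n = m + 1 := ⟨n - 1, by have := j.pos; omega⟩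
  set e := (MeasurableEquiv.piFinSuccAbove (fun _ : Fin (m + 1) => ℝ) j).symm.trans
    (MeasurableEquiv.toLp 2 (Fin (m + 1) → ℝ)) with he
  have hmp : MeasurePreserving e (volume.prod volume) volume :=
    (volume_preserving_piFinSuccAbove (fun _ : Fin (m + 1) => ℝ) j).symm.trans
      (EuclideanSpace.volume_preserving_symm_measurableEquiv_toLp (Fin (m + 1))).symm
  rw [← hmp.integral_comp e.measurableEmbedding,
    integral_prod_symm (fun w => H (e w)) (hmp.integrable_comp_of_integrable hH)]
  refine integral_eq_zero_of_ae (Eventually.of_forall fun y => ?_)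
  refine Eq.trans ?_ (h (j.insertNth 0 y))
  refine integral_congr_ae (Eventually.of_forall fun s => ?_)
  simp only [Fin.update_insertNth]
  rfl

/-- Let only the `j`-th variable become complex. The kernel then has modulus `exp (2π xⱼ Im w)`,
which in one of the two half planes offsets the growth `exp (2π a |Im w|)` of `ζ`. What remains is
quadratic decay, so Cauchy's theorem kills the integral in that variable. No exponential gain is
needed, so the case `|x j| = a` is included. -/
lemma ZSpace.inv_eq_zero {n : ℕ} {a : ℝ} (ζ : ZSpace n a) {x : EuclideanSpace ℝ (Fin n)}
    {j : Fin n} (hx : a ≤ |x j|) : ζ.inv x = 0 := by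
  rw [ZSpace.inv, Real.fourier_eq']
  refine integral_eq_zero_of_integral_update_eq_zero j fun v => ?_
  set z : ℂ → Fin n → ℂ := fun w => Function.update (twoPiPoint (WithLp.toLp 2 v)) j
    (2 * Real.pi * w) with hz
  set c : ℂ := ∑ k ∈ Finset.univ.erase j, (x k : ℂ) * v k with hc
  set g : ℂ → ℂ := fun w =>
    Complex.exp (-2 * Real.pi * (x j * w + c) * Complex.I) * ζ (z w) with hg
  have hgd : Differentiable ℂ g := by
    have h1 : Differentiable ℂ z := by
      refine differentiable_pi.2 fun k => ?_
      by_cases hk : k = j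
      · subst hk
        simpa [hz] using (differentiable_id.const_mul (2 * Real.pi : ℂ))
      · simp [hz, hk]
    have h2 : Differentiable ℂ fun w => ζ (z w) := ζ.2.1.comp h1
    exact Differentiable.mul (by fun_prop) h2
  have hgs (s : ℝ) : Complex.exp ((-2 * Real.pi *
      inner ℝ (WithLp.toLp 2 (Function.update v j s)) x : ℝ) * Complex.I) •
        ζ (twoPiPoint (WithLp.toLp 2 (Function.update v j s))) = g s := by
    have hzs : twoPiPoint (WithLp.toLp 2 (Function.update v j s)) = z s := by
      funext k
      by_cases hk : k = j
      · subst hk; simp [hz, twoPiPoint]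
      · simp [hz, twoPiPoint, hk]
    rw [hg, hzs, smul_eq_mul]
    congr 3
    have : (inner ℝ (WithLp.toLp 2 (Function.update v j s)) x : ℂ) = x j * s + c := by
      rw [PiLp.inner_apply, ← Finset.add_sum_erase _ _ (Finset.mem_univ j), hc]
      push_cast
      congr 1
      · simp
      · refine Finset.sum_congr rfl fun k hk => ?_
        simp [Finset.ne_of_mem_erase hk]
    push_cast [← this]
    rfl
  simp only [hgs]
  have him (w : ℂ) : imNorm (z w) = 2 * Real.pi * |w.im| := by
    rw [imNorm, Finset.sum_eq_single j]
    · simp [hz, abs_mul, abs_of_pos Real.pi_pos]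
    · intro k _ hk
      simp [hz, hk, twoPiPoint]
    · simp
  have hzn (w : ℂ) : ‖w‖ ≤ ‖z w‖ := by
    refine le_trans ?_ (norm_le_pi_norm (z w) j)
    have : z w j = 2 * Real.pi * w := by simp [hz]
    rw [this, norm_mul]
    refine le_mul_of_one_le_left (norm_nonneg _) ?_
    have : ‖(2 * Real.pi : ℂ)‖ = 2 * Real.pi := by
      simp [abs_of_pos Real.pi_pos]
    rw [this]
    linarith [Real.pi_gt_three]
  have hcim : c.im = 0 := by simp [hc]
  -- The hypothesis says that the kernel and growth exponents add up to at most 0; the norm of order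
  -- 2 supplies the decay.
  have hgn (w : ℂ) (hw : a * |w.im| + x j * w.im ≤ 0) :
      (1 + ‖w‖) ^ 2 * ‖g w‖ ≤ 2 ^ 2 * zNorm n a 2 ζ := by
    have he : ‖Complex.exp (-2 * Real.pi * (x j * w + c) * Complex.I)‖ =
        Real.exp (2 * Real.pi * (x j * w.im)) := by
      rw [Complex.norm_exp]
      congr 1
      simp [hcim]
    calc (1 + ‖w‖) ^ 2 * ‖g w‖
        = Real.exp (2 * Real.pi * (x j * w.im)) * ((1 + ‖w‖) ^ 2 * ‖ζ (z w)‖) := by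
          rw [hg, norm_mul, he]; ring
      _ ≤ Real.exp (2 * Real.pi * (x j * w.im)) * ((1 + ‖z w‖) ^ 2 * ‖ζ (z w)‖) := by
          gcongr; exact hzn w
      _ ≤ Real.exp (2 * Real.pi * (x j * w.im)) *
          (2 ^ 2 * zNorm n a 2 ζ * Real.exp (a * (2 * Real.pi * |w.im|))) := by
          refine mul_le_mul_of_nonneg_left ?_ (Real.exp_nonneg _)
          rw [← him]
          exact ζ.pow_mul_norm_le 2 (z w)
      _ = 2 ^ 2 * zNorm n a 2 ζ * Real.exp (2 * Real.pi * (a * |w.im| + x j * w.im)) := by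
          rw [mul_left_comm, ← Real.exp_add]; ring_nf
      _ ≤ 2 ^ 2 * zNorm n a 2 ζ * 1 := by
          gcongr
          exact Real.exp_le_one_iff.2 (mul_nonpos_of_nonneg_of_nonpos (by positivity) hw)
      _ = _ := mul_one _
  -- For `x j ≤ -a` the upper half plane works; for `x j ≥ a` the lower one does, reached by `w ↦
  -- -w`.
  rcases le_abs'.1 hx with hx | hx
  · refine integral_eq_zero_of_decay_upper hgd fun w hw => hgn w ?_
    rw [abs_of_nonneg hw]
    nlinarith
  · rw [← integral_neg_eq_self]
    have := integral_eq_zero_of_decay_upper (g := fun w => g (-w))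
      (hgd.comp differentiable_neg) (C := 2 ^ 2 * zNorm n a 2 ζ) fun w hw => ?_
    · simpa using this
    · have := hgn (-w) (by
        rw [Complex.neg_im, abs_neg, abs_of_nonneg hw]
        nlinarith)
      rwa [norm_neg] at this

/-- The support lies in the cube `|x j| ≤ a`, and the Euclidean norm there is at most the sum of the
coordinates' absolute values. The loss from `a` to `n * a` is harmless in the union `Z`. -/
lemma ZSpace.smoothIn_inv {n : ℕ} {a : ℝ} (ζ : ZSpace n a) : SmoothIn n (n * a) ζ.inv := by
  refine ⟨ζ.contDiff_inv, fun x hx => ?_⟩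
  by_contra h
  refine not_le.2 hx ((EuclideanSpace.norm_le_sum_norm x).trans ?_)
  calc ∑ j, ‖x j‖ ≤ ∑ _j : Fin n, a :=
        Finset.sum_le_sum fun j _ => (not_le.1 fun hj => h (ζ.inv_eq_zero hj)).le
    _ = n * a := by simp

/-- Inversion gives equality at real points only; compact support of `ζ.inv` makes its transform
entire, so the equality extends to `ℂⁿ`. -/
lemma ZSpace.fourierInt_inv {n : ℕ} {a : ℝ} (ζ : ZSpace n a) : fourierInt ζ.inv = ζ := by
  have hs := ζ.smoothIn_inv
  have hint : Integrable ζ.inv := by simpa using hs.integrable (fun _ => 1) continuous_const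
  refine sub_eq_zero.1 (Differentiable.eq_zero_of_real (hs.differentiable.sub ζ.2.1) fun x => ?_)
  have h := ζ.fourierInt_inv_twoPiPoint hint (WithLp.toLp 2 fun j => (2 * Real.pi)⁻¹ * x j)
  have hx : twoPiPoint (WithLp.toLp 2 fun j => (2 * Real.pi)⁻¹ * x j) = fun j => (x j : ℂ) := by
    funext j
    have hpi : (Real.pi : ℂ) ≠ 0 := by simp [Real.pi_ne_zero]
    simp only [twoPiPoint]
    push_cast
    field_simp
  rw [hx] at h
  simp [h]

/-! ### The Fourier transform as a homeomorphism -/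

lemma LinearMap.isHomeomorph_of_continuous_symm {E G : Type*} [AddCommGroup E] [Module ℂ E]
    [AddCommGroup G] [Module ℂ G] [TopologicalSpace E] [TopologicalSpace G] {F : E →ₗ[ℂ] G}
    (hF : Bijective F) (hc : Continuous F)
    (hc' : Continuous (LinearEquiv.ofBijective F hF).symm) : IsHomeomorph F :=
  isHomeomorph_iff_exists_inverse.2 ⟨hc, _, (LinearEquiv.ofBijective F hF).symm_apply_apply,
    (LinearEquiv.ofBijective F hF).apply_symm_apply, hc'⟩

/-- The radii may differ because `ZSpace.inv` depends only on the underlying function, not on `a`.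
-/
lemma SmoothIn.eq_of_fourierInt_eq {n : ℕ} {a b : ℝ} {f g : EuclideanSpace ℝ (Fin n) → ℂ}
    (hf : SmoothIn n a f) (hg : SmoothIn n b g) (h : fourierInt f = fourierInt g) : f = g := by
  rw [← hf.inv_fourierInt, ← hg.inv_fourierInt]
  simp only [ZSpace.inv, h]

lemma fourierDa_bijective (n : ℕ) (a : ℝ) : Bijective (fourierDa n a) := by
  refine ⟨fun ξ η h => DFunLike.coe_injective ?_, (fourierDaZ n a).surjective_rangeRestrict⟩
  exact ξ.smoothIn.eq_of_fourierInt_eq η.smoothIn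
    (congrArg (fun ζ : FTestDa n a => (ζ.1.1 : (Fin n → ℂ) → ℂ)) h)

lemma fourierDa_isHomeomorph (n : ℕ) (a : ℝ) : IsHomeomorph (fourierDa n a) := by
  refine LinearMap.isHomeomorph_of_continuous_symm (fourierDa_bijective n a)
    (Continuous.subtype_mk (continuous_fourierSupportedIn (K := ballCompact n a) subset_rfl) _) ?_
  refine continuous_of_coe_eq_inv (ι := (FTestDa n a).subtype) IsInducing.subtypeVal
    (LinearEquiv.ofBijective _ (fourierDa_bijective n a)).symm.toLinearMap fun ζ => ?_
  obtain ⟨ξ, rfl⟩ := (fourierDa_bijective n a).2 ζ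
  have h : (LinearEquiv.ofBijective _ (fourierDa_bijective n a)).symm (fourierDa n a ξ) = ξ :=
    (LinearEquiv.ofBijective _ (fourierDa_bijective n a)).symm_apply_apply ξ
  change ((LinearEquiv.ofBijective _ (fourierDa_bijective n a)).symm (fourierDa n a ξ) :
    EuclideanSpace ℝ (Fin n) → ℂ) = _
  rw [h]
  exact ξ.smoothIn.inv_fourierInt.symm

/-! ### The inductive limit `Z` and the transform of `𝓓` -/

instance (n : ℕ) : IsTopologicalAddGroup (ZLim n) :=
  topologicalAddGroup_sInf fun _ ⟨_, ht, _, _⟩ => ht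

instance (n : ℕ) : ContinuousSMul ℝ (ZLim n) :=
  continuousSMul_sInf fun _ ⟨_, _, ht, _⟩ => ht

instance (n : ℕ) : LocallyConvexSpace ℝ (ZLim n) :=
  .sInf fun _ ⟨_, _, _, ht⟩ => ht

lemma ZSpace.continuous_toZLim {n : ℕ} {a : ℝ} (ha : 0 < a) :
    Continuous (ZSpace.toZLim (n := n) ha) :=
  continuous_iff_coinduced_le.2 (le_sInf fun _ ht => ht.1 a ha)

/-- The universal property of the inductive limit topology of `Z`. -/
lemma ZLim.continuous_of_comp {n : ℕ} {V : Type*} [AddCommGroup V] [Module ℝ V]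
    [t : TopologicalSpace V] [IsTopologicalAddGroup V] [ContinuousSMul ℝ V]
    [LocallyConvexSpace ℝ V] (T : ZLim n →ₗ[ℝ] V)
    (hT : ∀ (a : ℝ) (ha : 0 < a), Continuous (T ∘ ZSpace.toZLim (n := n) ha)) : Continuous T :=
  -- The topology induced by `T` is itself one of those whose infimum defines the topology of `Z`.
  continuous_iff_le_induced.2 <| sInf_le
    ⟨fun a ha => by
      rw [← continuous_iff_le_induced, continuous_coinduced_dom]
      exact hT a ha,
      topologicalAddGroup_induced _, continuousSMul_induced _, .induced _⟩

lemma ZSpace.fourierD_inv {n : ℕ} {a : ℝ} (ha : 0 < a) (ζ : ZSpace n a) (ξ : TestD n)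
    (h : (ξ : EuclideanSpace ℝ (Fin n) → ℂ) = ζ.inv) : fourierD n ξ = ζ.toZLim ha :=
  Subtype.ext ((congrArg fourierInt h).trans ζ.fourierInt_inv)

/-- Both sides are smooth with compact support and have the same transform, so injectivity of `F`
applies. -/
lemma ZSpace.inv_add {n : ℕ} {a : ℝ} (ζ η : ZSpace n a) :
    (ζ + η).inv = fun x => ζ.inv x + η.inv x := by
  have hs : SmoothIn n (n * a) fun x => ζ.inv x + η.inv x :=
    ⟨ζ.smoothIn_inv.1.add η.smoothIn_inv.1, fun x hx => by
      simp only [ζ.smoothIn_inv.2 x hx, η.smoothIn_inv.2 x hx, add_zero]⟩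
  refine (ζ + η).smoothIn_inv.eq_of_fourierInt_eq hs ?_
  rw [ζ.smoothIn_inv.fourierInt_add η.smoothIn_inv, fourierInt_inv, fourierInt_inv, fourierInt_inv]
  rfl

lemma ZSpace.inv_smul {n : ℕ} {a : ℝ} (c : ℂ) (ζ : ZSpace n a) :
    (c • ζ).inv = fun x => c * ζ.inv x := by
  have hs : SmoothIn n (n * a) fun x => c * ζ.inv x :=
    ⟨contDiff_const.mul ζ.smoothIn_inv.1, fun x hx => by
      simp only [ζ.smoothIn_inv.2 x hx, mul_zero]⟩
  refine (c • ζ).smoothIn_inv.eq_of_fourierInt_eq hs ?_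
  rw [fourierInt_smul, fourierInt_inv, fourierInt_inv]
  rfl

/-- The inverse Fourier transform `Z(a) → 𝓓_{na}`. -/
noncomputable def ZSpace.invLM (n : ℕ) (a : ℝ) : ZSpace n a →ₗ[ℂ] TestDa n (n * a) where
  toFun ζ := ⟨ζ.inv, ζ.contDiff_inv, fun x hx => ζ.smoothIn_inv.2 x (by
    change x ∉ Metric.closedBall (0 : EuclideanSpace ℝ (Fin n)) (n * a) at hx
    simpa using hx)⟩
  map_add' ζ η := DFunLike.coe_injective (ζ.inv_add η)
  map_smul' c ζ := DFunLike.coe_injective (ζ.inv_smul c)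

lemma ZSpace.continuous_invLM (n : ℕ) (a : ℝ) : Continuous (ZSpace.invLM n a) :=
  continuous_of_coe_eq_inv (ι := LinearMap.id) IsInducing.id _ fun _ => rfl

lemma fourierD_bijective (n : ℕ) : Bijective (fourierD n) := by
  refine ⟨fun ξ η h => DFunLike.coe_injective ?_, ?_⟩
  · obtain ⟨a, _, hξ⟩ := ξ.smoothIn
    obtain ⟨b, _, hη⟩ := η.smoothIn
    exact hξ.eq_of_fourierInt_eq hη (congrArg Subtype.val h)
  · rintro ⟨ζ, a, ha, hζ⟩
    exact ⟨TestFunction.ofSupportedIn (Set.subset_univ _) (ZSpace.invLM n a ⟨ζ, hζ⟩),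
      ZSpace.fourierD_inv ha ⟨ζ, hζ⟩ _ rfl⟩

lemma continuous_fourierD (n : ℕ) : Continuous (fourierD n) := by
  refine (TestFunction.continuous_iff_continuous_comp _).2 fun K _ => ?_
  obtain ⟨r, hr⟩ := K.isCompact.isBounded.subset_closedBall 0
  -- The maximum with 1 makes the radius positive, as the inclusion `Z(a) → Z` requires.
  have hK : (K : Set (EuclideanSpace ℝ (Fin n))) ⊆ Metric.closedBall 0 (max r 1) :=
    hr.trans (Metric.closedBall_subset_closedBall (le_max_left r 1))
  exact (ZSpace.continuous_toZLim (lt_max_of_lt_right one_pos)).comp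
    (continuous_fourierSupportedIn hK)

lemma fourierD_isHomeomorph (n : ℕ) : IsHomeomorph (fourierD n) := by
  refine LinearMap.isHomeomorph_of_continuous_symm (fourierD_bijective n)
    (continuous_fourierD n) ?_
  set e := LinearEquiv.ofBijective _ (fourierD_bijective n)
  -- The topology of `Z` is defined by local convexity over `ℝ`, so its universal property is used
  -- for the underlying real-linear map.
  refine ZLim.continuous_of_comp (e.symm.toLinearMap.restrictScalars ℝ) fun a ha => ?_
  have hcomp : (e.symm.toLinearMap.restrictScalars ℝ) ∘ ZSpace.toZLim (n := n) ha =
      fun ζ => TestFunction.ofSupportedIn (Set.subset_univ _) (ZSpace.invLM n a ζ) := by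
    funext ζ
    exact e.symm_apply_eq.2 (ZSpace.fourierD_inv ha ζ _ rfl).symm
  rw [hcomp]
  exact (TestFunction.continuous_ofSupportedIn _).comp (ZSpace.continuous_invLM n a)

/-! ### The three cases of the theorem -/

theorem theorem3p1 (n : ℕ) (γ : ℂ → ℂ) (hγ : γ ∈ CZero) :
    -- the case `E = 𝓓_a`
    (∀ a : ℝ, 0 < a →
      Bijective (fourierDa n a) ∧
      ∀ U ∈ 𝓝 (0 : TestDa n a),
        (fourierDa n a) '' U ∈ 𝓝 0 ∧
        (∀ (f : TestDa n a → ℂ) (ξ : TestDa n a),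
          fourierFunctional n (fourierDa n a) f (fourierDa n a ξ) = (2 * (Real.pi : ℂ)) ^ n * f ξ) ∧
        Set.BijOn (fourierFunctional n (fourierDa n a)) (DemiDist γ U) (DemiDist γ ((fourierDa n a) '' U)) ∧
        (∀ (m : ℕ) (α : Fin m → ℂ) (f : Fin m → TestDa n a → ℂ), (∀ k, f k ∈ DemiDist γ U) →
          fourierFunctional n (fourierDa n a) (∑ k, α k • f k) =
              ∑ k, α k • fourierFunctional n (fourierDa n a) (f k) ∧
            fourierFunctional n (fourierDa n a) (∑ k, α k • f k) ∈ DemiDistSpan γ ((fourierDa n a) '' U)) ∧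
        Set.BijOn (fourierFunctional n (fourierDa n a)) (DemiDistSpan γ U)
          (DemiDistSpan γ ((fourierDa n a) '' U)) ∧
        ∃ T : DemiDistSpan γ U →ₗ[ℂ] DemiDistSpan γ ((fourierDa n a) '' U),
          Continuous T ∧ ∀ f : DemiDistSpan γ U, (T f).1 = fourierFunctional n (fourierDa n a) f.1) ∧
    -- the case `E = 𝓓`, where `F(E) = Z`
    (Bijective (fourierD n) ∧
      ∀ U ∈ 𝓝 (0 : TestD n),
        (fourierD n) '' U ∈ 𝓝 0 ∧
        (∀ (f : TestD n → ℂ) (ξ : TestD n),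
          fourierFunctional n (fourierD n) f (fourierD n ξ) = (2 * (Real.pi : ℂ)) ^ n * f ξ) ∧
        Set.BijOn (fourierFunctional n (fourierD n)) (DemiDist γ U) (DemiDist γ ((fourierD n) '' U)) ∧
        (∀ (m : ℕ) (α : Fin m → ℂ) (f : Fin m → TestD n → ℂ), (∀ k, f k ∈ DemiDist γ U) →
          fourierFunctional n (fourierD n) (∑ k, α k • f k) =
              ∑ k, α k • fourierFunctional n (fourierD n) (f k) ∧
            fourierFunctional n (fourierD n) (∑ k, α k • f k) ∈ DemiDistSpan γ ((fourierD n) '' U)) ∧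
        Set.BijOn (fourierFunctional n (fourierD n)) (DemiDistSpan γ U)
          (DemiDistSpan γ ((fourierD n) '' U)) ∧
        ∃ T : DemiDistSpan γ U →ₗ[ℂ] DemiDistSpan γ ((fourierD n) '' U),
          Continuous T ∧ ∀ f : DemiDistSpan γ U, (T f).1 = fourierFunctional n (fourierD n) f.1) ∧
    -- the case `E = 𝓢`, where `F(E) = 𝓢`
    (Bijective (fourierS n) ∧
      ∀ U ∈ 𝓝 (0 : TestS n),
        (fourierS n) '' U ∈ 𝓝 0 ∧
        (∀ (f : TestS n → ℂ) (ξ : TestS n),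
          fourierFunctional n (fourierS n) f (fourierS n ξ) = (2 * (Real.pi : ℂ)) ^ n * f ξ) ∧
        Set.BijOn (fourierFunctional n (fourierS n)) (DemiDist γ U) (DemiDist γ ((fourierS n) '' U)) ∧
        (∀ (m : ℕ) (α : Fin m → ℂ) (f : Fin m → TestS n → ℂ), (∀ k, f k ∈ DemiDist γ U) →
          fourierFunctional n (fourierS n) (∑ k, α k • f k) =
              ∑ k, α k • fourierFunctional n (fourierS n) (f k) ∧
            fourierFunctional n (fourierS n) (∑ k, α k • f k) ∈ DemiDistSpan γ ((fourierS n) '' U)) ∧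
        Set.BijOn (fourierFunctional n (fourierS n)) (DemiDistSpan γ U)
          (DemiDistSpan γ ((fourierS n) '' U)) ∧
        ∃ T : DemiDistSpan γ U →ₗ[ℂ] DemiDistSpan γ ((fourierS n) '' U),
          Continuous T ∧ ∀ f : DemiDistSpan γ U, (T f).1 = fourierFunctional n (fourierS n) f.1) :=
  ⟨fun a _ => fourierFunctional_of_isHomeomorph n γ (fourierDa_isHomeomorph n a),
    fourierFunctional_of_isHomeomorph n γ (fourierD_isHomeomorph n),
    fourierFunctional_of_isHomeomorph n γ (fourierS_isHomeomorph n)⟩
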